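/- Let $a<b$ be real numbers and let $\mu$ be a Borel probability measure on $[a,b]$ with density $$\frac{d\mu}{dt}(t)=\frac{g(t)}{\pi\sqrt{(t-a)(b-t)}},\qquad t\in(a,b),$$ where $g$ is non-negative, concave and increasing (in the weak sense) on $(a,b)$ and $t\mapsto g(t)/(t-a)$ is convex on $(a,b)$. For $z\in\mathbb C$ let $U^\mu(z)=\int\log\frac1{|z-t|}\,d\mu(t)$ be the logarithmic potential of $\mu$. This integral converges absolutely for every $z\in\mathbb C$. Put $C_{BW}=15383$, a universal constant that depends neither on $a,b,g,\mu$ nor on $k$. For every integer $k\ge2$ there are points $a=t_0<t_1<\dots<t_k=b$ with $\mu([t_j,t_{j+1}])=1/k$ for $j=0,\dots,k-1$, such that, with the weighted midpoints $$\xi_j=\frac{\int_{t_j}^{t_{j+1}}t\,d\mu(t)}{\int_{t_j}^{t_{j+1}}d\mu(t)},\qquad j=0,\dots,k-1,$$ the monic polynomial $P_k(z)=\prod_{j=0}^{k-1}(z-\xi_j)$ of degree $k$ satisfies (a) $\log|P_k(z)|+k\,U^\mu(z)\le C_{BW}$ for all $z\in\mathbb C$, and (b) $\log|P_k(x)|+k\,U^\mu(x)\ge0$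 for all $x\in\mathbb R\setminus(a,b)$, where $\log 0=-\infty$. -/

import Mathlib

open MeasureTheory Polynomial

/-- The logarithmic potential `U^μ(z) = ∫ log (1 / |z - t|) dμ(t)` of a measure on the real line,
at a point of the complex plane. It is used below only for measures without atoms (so that the
value of the integrand at `t = z` is immaterial) for which the integrand is integrable; that it is
integrable is part of the theorem. -/
noncomputable def logPotential (μ : Measure ℝ) (z : ℂ) : ℝ :=
  ∫ t : ℝ, Real.log (1 / ‖z - (t : ℂ)‖) ∂μ

/-- The logarithm of the absolute value of `p` at `z`, with value `-∞` at the zeros of `p`. -/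
noncomputable def logAbs (p : ℝ[X]) (z : ℂ) : EReal :=
  ENNReal.log ‖aeval z p‖ₑ

/-- The points `a = t₀ < t₁ < ⋯ < t_k = b` cut `[a, b]` into `k` intervals of `μ`-mass `1 / k`. -/
structure IsEqualMassPartition (μ : Measure ℝ) (a b : ℝ) (k : ℕ) (t : Fin (k + 1) → ℝ) :
    Prop where
  strictMono : StrictMono t
  left : t 0 = a
  right : t (Fin.last k) = b
  mass : ∀ j : Fin k, μ.real (Set.Icc (t j.castSucc) (t j.succ)) = 1 / (k : ℝ)

/-- The weighted midpoint `ξ_j = ∫_{t_j}^{t_{j+1}} s dμ(s) / ∫_{t_j}^{t_{j+1}} dμ(s)`. -/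
noncomputable def weightedMidpoint (μ : Measure ℝ) {k : ℕ} (t : Fin (k + 1) → ℝ) (j : Fin k) : ℝ :=
  (∫ s in Set.Icc (t j.castSucc) (t j.succ), s ∂μ) / μ.real (Set.Icc (t j.castSucc) (t j.succ))

/-- The monic polynomial `∏ j, (X - ξ_j)` whose zeros are the weighted midpoints. -/
noncomputable def weightedMidpointPolynomial (μ : Measure ℝ) {k : ℕ} (t : Fin (k + 1) → ℝ) :
    ℝ[X] :=
  ∏ j : Fin k, (X - C (weightedMidpoint μ t j))

/-- The universal constant. -/
def constBW : ℝ := 15383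

/-! Since each `ξ_j` carries mass `1 / k`, `log |P_k(z)| + k U^μ(z)` equals `k` times the sum over
the partition intervals of `∫ (log |z - ξ_j| - log |z - t|) dμ(t)`. As `ξ_j` is the mean of its
interval, an integrand linear in `t - ξ_j` contributes nothing. For (b), `t ↦ log |x - t|` is
concave on `(a, b)` when `x` lies outside, so Jensen's inequality makes every term non-negative. For
(a), the substitution `t = a + (b - a)(1 - cos θ)/2` turns the arcsine weight into `dθ` and `μ` into
a density `D = g / π`. Monotonicity of `g` makes `D` increasing; concavity and non-negativity make
`g(t)/(t - a)`, hence `D(θ)/sin²(θ/2)`, decreasing. These two properties (`IsAngularDensity`) are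
all that the estimates use: on any interval the mass is comparable with length times the value at
the right end (`le_integral`, `integral_le`). Let `φ` be the angle of the point of `[a, b]` nearest
to `z`. An interval close to `φ` costs at most `15 / k`, because the logarithmic singularity is
integrable (`integral_log_sub_le_near`). For an interval of length `h` at distance `d > 0` from `z`,
a Taylor bound costs `(3/2)(h/d)²/k` (`integral_log_sub_le_far`). If `W` is the distance from the
image of `φ` to the far end of an interval `N` steps away, counting masses gives `h/W = O(N^(-2/3))`
(`length_ratio_right`, `length_ratio_left`). The costs are therefore `O(N^(-4/3)/k)`, and their sum
is bounded uniformly in `k`. -/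

/-- The parametrisation `θ ↦ a + (b - a) (1 - cos θ) / 2` of `[a, b]` by the angle `θ ∈ [0, π]`. -/
noncomputable def arcParam (a b θ : ℝ) : ℝ := a + (b - a) * (1 - Real.cos θ) / 2

/-! ### Lengths and distances under the cosine parametrisation. -/

section Trigonometry

open Real

theorem arcParam_sub (a b α β : ℝ) :
    arcParam a b β - arcParam a b α = (b - a) * (sin ((α + β) / 2) * sin ((β - α) / 2)) := by
  have h := cos_sub_cos α β
  have h2 : sin ((α - β) / 2) = - sin ((β - α) / 2) := by rw [← sin_neg]; congr 1; ring
  rw [h2] at h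
  unfold arcParam
  linear_combination (b - a) / 2 * h

theorem arcParam_zero (a b : ℝ) : arcParam a b 0 = a := by simp [arcParam]

theorem arcParam_pi (a b : ℝ) : arcParam a b π = b := by simp [arcParam]; ring

theorem continuous_arcParam (a b : ℝ) : Continuous (arcParam a b) := by
  unfold arcParam; fun_prop

theorem hasDerivAt_arcParam (a b θ : ℝ) :
    HasDerivAt (arcParam a b) ((b - a) * sin θ / 2) θ := by
  have h := ((((hasDerivAt_cos θ).const_sub 1).const_mul (b - a)).div_const 2).const_add a
  exact h.congr_deriv (by ring)

theorem strictMonoOn_arcParam {a b : ℝ} (hab : a < b) :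
    StrictMonoOn (arcParam a b) (Set.Icc 0 π) := by
  intro x hx y hy hxy
  have := strictAntiOn_cos hx hy hxy
  unfold arcParam
  have : 0 < b - a := by linarith
  nlinarith

/-- Concavity of the sine: chords from the origin lie below the graph. -/
theorem div_mul_sin_le_sin {x y : ℝ} (hx : 0 ≤ x) (hxy : x ≤ y) (hy : 0 < y) (hyπ : y ≤ π) :
    x / y * sin y ≤ sin x := by
  have h := strictConcaveOn_sin_Icc.concaveOn.2 (show (0 : ℝ) ∈ Set.Icc 0 π from ⟨le_rfl, pi_pos.le⟩)
    (show y ∈ Set.Icc 0 π from ⟨hy.le, hyπ⟩)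
    (show 0 ≤ 1 - x / y by rw [sub_nonneg, div_le_one hy]; exact hxy)
    (show 0 ≤ x / y by positivity) (by ring)
  simp only [smul_eq_mul, mul_zero, sin_zero, zero_add] at h
  rwa [div_mul_cancel₀ _ hy.ne'] at h

/-- A quadratic lower bound for the distance between two points of a parametrised interval. -/
theorem arcParam_dist_lower {a b α β θ φ : ℝ} (hab : a < b) (hα : 0 ≤ α) (hαβ : α < β)
    (hβ : β ≤ π) (hθ : θ ∈ Set.Icc α β) (hφ : φ ∈ Set.Icc α β) :
    ((θ - φ) / (β - α)) ^ 2 * (arcParam a b β - arcParam a b α) ≤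
      |arcParam a b φ - arcParam a b θ| := by
  wlog h : θ ≤ φ generalizing θ φ
  · have := this hφ hθ (le_of_not_ge h)
    rw [abs_sub_comm]
    convert this using 2
    rw [← neg_sub φ θ, neg_div, neg_sq]
  rw [arcParam_sub, arcParam_sub]
  have hL : 0 < b - a := by linarith
  have hδ : 0 < β - α := by linarith
  obtain ⟨h1, h2⟩ := hθ
  obtain ⟨h3, h4⟩ := hφ
  set l := (φ - θ) / (β - α) with hl
  have hl0 : 0 ≤ l := div_nonneg (by linarith) hδ.le
  have hl1 : l ≤ 1 := by rw [hl, div_le_one hδ]; linarith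
  have hle : l * (β - α) = φ - θ := div_mul_cancel₀ _ hδ.ne'
  have e1 : ((θ - φ) / (β - α)) ^ 2 = l ^ 2 := by
    rw [hl, ← neg_sub φ θ, neg_div, neg_sq]
  have s1 : l * sin ((β - α) / 2) ≤ sin ((φ - θ) / 2) := by
    have := div_mul_sin_le_sin (x := (φ - θ) / 2) (y := (β - α) / 2) (by linarith) (by linarith)
      (by linarith) (by linarith)
    rwa [div_div_div_cancel_right₀ two_ne_zero] at this
  have hc := strictConcaveOn_sin_Icc.concaveOn
  -- The midpoint of `θ` and `φ` lies between the points that divide the segments from `α` and from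
  -- `β` to their midpoint in ratio `l`. Concavity bounds the sine below at both points, and a
  -- concave function on a segment is at least its smaller end value.
  have s2 : l * sin ((α + β) / 2) ≤ sin ((θ + φ) / 2) := by
    have hα' : α ∈ Set.Icc 0 π := ⟨hα, by linarith⟩
    have hβ' : β ∈ Set.Icc 0 π := ⟨by linarith, hβ⟩
    have hm' : (α + β) / 2 ∈ Set.Icc 0 π := ⟨by linarith, by linarith⟩
    have hl' : 0 ≤ 1 - l := by linarith
    have c1 := hc.2 hα' hm' hl' hl0 (by ring)
    have c2 := hc.2 hβ' hm' hl' hl0 (by ring)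
    simp only [smul_eq_mul] at c1 c2
    have p1 : 0 ≤ sin α := sin_nonneg_of_nonneg_of_le_pi hα (by linarith)
    have p2 : 0 ≤ sin β := sin_nonneg_of_nonneg_of_le_pi (by linarith) hβ
    have p3 : 0 ≤ (1 - l) * sin α := mul_nonneg (by linarith) p1
    have p4 : 0 ≤ (1 - l) * sin β := mul_nonneg (by linarith) p2
    have hmin := hc.min_le_of_mem_Icc
      (x := (1 - l) * α + l * ((α + β) / 2)) (y := (1 - l) * β + l * ((α + β) / 2))
      (z := (θ + φ) / 2) ⟨by nlinarith, by nlinarith⟩ ⟨by nlinarith, by nlinarith⟩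
      ⟨by nlinarith, by nlinarith⟩
    rcases min_le_iff.1 hmin with h | h <;> linarith
  have q1 : 0 ≤ sin ((β - α) / 2) := sin_nonneg_of_nonneg_of_le_pi (by linarith) (by linarith)
  have q2 : 0 ≤ sin ((α + β) / 2) := sin_nonneg_of_nonneg_of_le_pi (by linarith) (by linarith)
  rw [e1]
  refine le_trans ?_ (le_abs_self _)
  have := mul_le_mul s2 s1 (by positivity) (le_trans (by positivity) s2)
  have := mul_le_mul_of_nonneg_left this hL.le
  linarith

/-- Lengths are products of two sines. The midpoint sines compare with factor 2, and the
half-difference sines with factor `π / 2` by `2x/π ≤ sin x ≤ x`. -/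
theorem arcParam_sub_le_right {a b φ α β : ℝ} (hab : a < b) (hφ : 0 ≤ φ) (hφα : φ ≤ α)
    (hαβ : α < β) (hβ : β ≤ π) :
    arcParam a b β - arcParam a b α ≤
      π * ((β - α) / (β - φ)) * (arcParam a b β - arcParam a b φ) := by
  rw [arcParam_sub, arcParam_sub]
  have hL : 0 < b - a := by linarith
  have s1 : sin ((α + β) / 2) ≤ 2 * sin ((φ + β) / 2) := by
    have := div_mul_sin_le_sin (x := (φ + β) / 2) (y := (α + β) / 2) (by linarith) (by linarith)
      (by linarith) (by linarith)
    have p : 0 ≤ sin ((α + β) / 2) := sin_nonneg_of_nonneg_of_le_pi (by linarith) (by linarith)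
    have q : 1 / 2 ≤ (φ + β) / 2 / ((α + β) / 2) := by
      rw [div_le_div_iff₀ (by norm_num) (by linarith)]; linarith
    nlinarith
  have s2 : sin ((β - α) / 2) ≤ π / 2 * ((β - α) / (β - φ)) * sin ((β - φ) / 2) := by
    have h1 := sin_le (x := (β - α) / 2) (by linarith)
    have h2 := mul_le_sin (x := (β - φ) / 2) (by linarith) (by linarith)
    refine h1.trans ?_
    have : (β - α) / 2 = π / 2 * ((β - α) / (β - φ)) * (2 / π * ((β - φ) / 2)) := by
      have : β - φ ≠ 0 := by linarith
      field_simp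
    rw [this]
    refine mul_le_mul_of_nonneg_left h2 ?_
    have : 0 ≤ (β - α) / (β - φ) := div_nonneg (by linarith) (by linarith)
    positivity
  have p1 : 0 ≤ sin ((β - α) / 2) := sin_nonneg_of_nonneg_of_le_pi (by linarith) (by linarith)
  have p2 : 0 ≤ sin ((φ + β) / 2) := sin_nonneg_of_nonneg_of_le_pi (by linarith) (by linarith)
  have := mul_le_mul s1 s2 p1 (by positivity)
  have := mul_le_mul_of_nonneg_left this hL.le
  linarith

/-- The parametrisation is quadratic at `a`, so an interval to the left of `φ` is shorter by the
additional factor `sin (β / 2) / sin (φ / 2)`. That gain offsets the possible smallness of the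
density there. -/
theorem arcParam_sub_le_left {a b φ α β : ℝ} (hab : a < b) (hα : 0 ≤ α) (hαβ : α < β)
    (hβφ : β ≤ φ) (hφ : φ ≤ π) :
    arcParam a b β - arcParam a b α ≤
      π * ((sin (β / 2) / sin (φ / 2)) * ((β - α) / (φ - α))) *
        (arcParam a b φ - arcParam a b α) := by
  rw [arcParam_sub, arcParam_sub]
  have hL : 0 < b - a := by linarith
  have hφ0 : 0 < sin (φ / 2) := sin_pos_of_pos_of_lt_pi (by linarith) (by linarith)
  have hβ0 : 0 < sin (β / 2) := sin_pos_of_pos_of_lt_pi (by linarith) (by linarith)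
  have hα0 : 0 ≤ sin (α / 2) := sin_nonneg_of_nonneg_of_le_pi (by linarith) (by linarith)
  have cφ : 0 ≤ cos (φ / 2) := cos_nonneg_of_neg_pi_div_two_le_of_le (by linarith) (by linarith)
  have s1 : sin ((α + β) / 2) ≤ 2 * (sin (β / 2) / sin (φ / 2)) * sin ((α + φ) / 2) := by
    have e1 : sin ((α + β) / 2) =
        sin (α / 2) * cos (β / 2) + cos (α / 2) * sin (β / 2) := by rw [← sin_add]; congr 1; ring
    have e2 : sin ((α + φ) / 2) =
        sin (α / 2) * cos (φ / 2) + cos (α / 2) * sin (φ / 2) := by rw [← sin_add]; congr 1; ring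
    have m1 : sin (α / 2) ≤ sin (β / 2) :=
      sin_le_sin_of_le_of_le_pi_div_two (by linarith) (by linarith) (by linarith)
    have m2 : cos (β / 2) ≤ cos (α / 2) :=
      cos_le_cos_of_nonneg_of_le_pi (by linarith) (by linarith) (by linarith)
    have cβ : 0 ≤ cos (β / 2) := cos_nonneg_of_neg_pi_div_two_le_of_le (by linarith) (by linarith)
    have m3 : sin (α / 2) * cos (β / 2) ≤ sin (β / 2) * cos (α / 2) :=
      mul_le_mul m1 m2 cβ hβ0.le
    have e3 : 2 * (sin (β / 2) / sin (φ / 2)) * (cos (α / 2) * sin (φ / 2)) =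
        2 * (sin (β / 2) * cos (α / 2)) := by field_simp
    have : 0 ≤ 2 * (sin (β / 2) / sin (φ / 2)) * (sin (α / 2) * cos (φ / 2)) := by positivity
    rw [e1, e2, mul_add, e3]
    linarith
  have s2 : sin ((β - α) / 2) ≤ π / 2 * ((β - α) / (φ - α)) * sin ((φ - α) / 2) := by
    have h1 := sin_le (x := (β - α) / 2) (by linarith)
    have h2 := mul_le_sin (x := (φ - α) / 2) (by linarith) (by linarith)
    refine h1.trans ?_
    have : (β - α) / 2 = π / 2 * ((β - α) / (φ - α)) * (2 / π * ((φ - α) / 2)) := by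
      have : φ - α ≠ 0 := by linarith
      field_simp
    rw [this]
    refine mul_le_mul_of_nonneg_left h2 ?_
    have : 0 ≤ (β - α) / (φ - α) := div_nonneg (by linarith) (by linarith)
    positivity
  have p1 : 0 ≤ sin ((β - α) / 2) := sin_nonneg_of_nonneg_of_le_pi (by linarith) (by linarith)
  have p2 : 0 ≤ sin ((α + φ) / 2) := sin_nonneg_of_nonneg_of_le_pi (by linarith) (by linarith)
  have := mul_le_mul s1 s2 p1 (by positivity)
  have := mul_le_mul_of_nonneg_left this hL.le
  linarith

theorem div_le_sin_div_sin {α β φ : ℝ} (hα : 0 ≤ α) (hαβ : α < β) (hβφ : β ≤ φ) (hφ : φ ≤ π) :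
    (β - α) / (φ - α) ≤ sin (β / 2) / sin (φ / 2) := by
  have hφ0 : 0 < sin (φ / 2) := sin_pos_of_pos_of_lt_pi (by linarith) (by linarith)
  have h := div_mul_sin_le_sin (x := β / 2) (y := φ / 2) (by linarith) (by linarith)
    (by linarith) (by linarith)
  rw [div_div_div_cancel_right₀ two_ne_zero] at h
  rw [← le_div_iff₀ hφ0] at h
  refine le_trans ?_ h
  rw [div_le_div_iff₀ (by linarith) (by linarith)]
  nlinarith

/-- A point of `[α, β]` whose image is the nearest point to `z` of the parametrised interval. -/
theorem exists_arcParam_nearest {a b α β : ℝ} (hab : a < b) (hα : 0 ≤ α) (hαβ : α ≤ β)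
    (hβ : β ≤ π) (z : ℂ) :
    ∃ φ ∈ Set.Icc α β, ∀ s ∈ Set.Icc (arcParam a b α) (arcParam a b β),
      |arcParam a b φ - s| ≤ ‖z - (s : ℂ)‖ := by
  have hle : arcParam a b α ≤ arcParam a b β :=
    (strictMonoOn_arcParam hab).monotoneOn ⟨hα, by linarith⟩ ⟨by linarith, hβ⟩ hαβ
  obtain ⟨φ, hφ, hφe⟩ := intermediate_value_Icc hαβ
    (continuous_arcParam a b).continuousOn (Set.projIcc _ _ hle z.re).2
  refine ⟨φ, hφ, fun s hs => ?_⟩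
  have h1 : |z.re - s| ≤ ‖z - (s : ℂ)‖ := by
    have := Complex.abs_re_le_norm (z - (s : ℂ))
    simpa using this
  refine le_trans ?_ h1
  rw [hφe, Set.coe_projIcc]
  obtain ⟨hs1, hs2⟩ := hs
  rcases le_total z.re (arcParam a b α) with h | h
  · rw [min_eq_right (by linarith), max_eq_left h, abs_sub_comm, abs_sub_comm z.re,
      abs_of_nonneg (by linarith), abs_of_nonneg (by linarith)]
    linarith
  · rcases le_total z.re (arcParam a b β) with h' | h'
    · rw [min_eq_right h', max_eq_right h]
    · rw [min_eq_left h', max_eq_right hle, abs_of_nonneg (by linarith),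
        abs_of_nonneg (by linarith)]
      linarith

end Trigonometry

/-! ### Angular densities and the cost of a single interval. -/

section AngularDensity

open Real intervalIntegral

/-- A non-negative increasing density on `[0, π]` whose quotient by `sin² (θ / 2)` decreases. -/
structure IsAngularDensity (D : ℝ → ℝ) : Prop where
  nonneg : ∀ θ ∈ Set.Icc 0 π, 0 ≤ D θ
  mono : MonotoneOn D (Set.Icc 0 π)
  anti : ∀ θ θ' : ℝ, 0 ≤ θ → θ ≤ θ' → θ' ≤ π → D θ' * sin (θ / 2) ^ 2 ≤ D θ * sin (θ' / 2) ^ 2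

variable {D : ℝ → ℝ} {a b α β : ℝ}

theorem IsAngularDensity.intervalIntegrable (hD : IsAngularDensity D) (hα : 0 ≤ α) (hαβ : α ≤ β)
    (hβ : β ≤ π) : IntervalIntegrable D volume α β := by
  apply MonotoneOn.intervalIntegrable
  rw [Set.uIcc_of_le hαβ]
  exact hD.mono.mono (Set.Icc_subset_Icc hα hβ)

theorem IsAngularDensity.intervalIntegrable_mul (hD : IsAngularDensity D) (hα : 0 ≤ α)
    (hαβ : α ≤ β) (hβ : β ≤ π) {f : ℝ → ℝ} (hf : IntervalIntegrable f volume α β) :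
    IntervalIntegrable (fun θ => f θ * D θ) volume α β := by
  have hm := hD.intervalIntegrable hα hαβ hβ
  rw [intervalIntegrable_iff_integrableOn_Ioc_of_le hαβ] at hf hm ⊢
  refine Integrable.mul_bdd (c := D π) hf hm.aestronglyMeasurable ?_
  refine (ae_restrict_iff' measurableSet_Ioc).2 (ae_of_all _ fun θ hθ => ?_)
  have h : θ ∈ Set.Icc 0 π := ⟨hα.trans hθ.1.le, hθ.2.trans hβ⟩
  rw [norm_eq_abs, abs_of_nonneg (hD.nonneg θ h)]
  exact hD.mono h ⟨pi_pos.le, le_rfl⟩ h.2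

theorem IsAngularDensity.integral_le (hD : IsAngularDensity D) (hα : 0 ≤ α)
    (hαβ : α ≤ β) (hβ : β ≤ π) : ∫ θ in α..β, D θ ≤ D β * (β - α) := by
  have := integral_mono_on hαβ (hD.intervalIntegrable hα hαβ hβ)
    (intervalIntegrable_const (c := D β))
    fun θ hθ => hD.mono ⟨hα.trans hθ.1, hθ.2.trans hβ⟩ ⟨hα.trans hαβ, hβ⟩ hθ.2
  rwa [intervalIntegral.integral_const, smul_eq_mul, mul_comm] at this

/-- The decreasing quotient and concavity of the sine give `D θ ≥ D β * θ² / β²`; integrating the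
square produces the factor 3. -/
theorem IsAngularDensity.le_integral (hD : IsAngularDensity D) (hα : 0 ≤ α)
    (hαβ : α ≤ β) (hβ : β ≤ π) : D β * (β - α) ≤ 3 * ∫ θ in α..β, D θ := by
  rcases hαβ.eq_or_lt with rfl | hlt
  · simp
  have hβ0 : 0 < β := by linarith
  have hDβ := hD.nonneg β ⟨hβ0.le, hβ⟩
  have := integral_mono_on (f := fun θ => D β / β ^ 2 * θ ^ 2) hαβ
    (Continuous.intervalIntegrable (by fun_prop) _ _) (hD.intervalIntegrable hα hαβ hβ)
    fun θ hθ => by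
      have h0 : 0 ≤ θ := hα.trans hθ.1
      have hs : 0 < sin (β / 2) := sin_pos_of_pos_of_lt_pi (by linarith) (by linarith)
      have h := div_mul_sin_le_sin (x := θ / 2) (y := β / 2) (by linarith) (by linarith [hθ.2])
        (by linarith) (by linarith)
      rw [div_div_div_cancel_right₀ two_ne_zero] at h
      have h2 : (θ / β * sin (β / 2)) ^ 2 ≤ sin (θ / 2) ^ 2 := by gcongr
      have h3 := (mul_le_mul_of_nonneg_left h2 hDβ).trans (hD.anti θ β h0 hθ.2 hβ)
      have h4 : 0 < sin (β / 2) ^ 2 := by positivity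
      refine le_of_mul_le_mul_right ?_ h4
      refine le_trans (le_of_eq ?_) h3
      field_simp
  rw [intervalIntegral.integral_const_mul, integral_pow] at this
  have h5 : D β * (β - α) ≤ 3 * (D β / β ^ 2 * ((β ^ (2 + 1) - α ^ (2 + 1)) / ((2 : ℕ) + 1))) := by
    have : 3 * (D β / β ^ 2 * ((β ^ (2 + 1) - α ^ (2 + 1)) / ((2 : ℕ) + 1))) =
      D β * ((β - α) * ((β ^ 2 + β * α + α ^ 2) / β ^ 2)) := by
      push_cast
      field_simp
      ring
    rw [this]
    have h6 : 1 ≤ (β ^ 2 + β * α + α ^ 2) / β ^ 2 := by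
      rw [one_le_div (by positivity)]; nlinarith [mul_nonneg hβ0.le hα, sq_nonneg α]
    refine mul_le_mul_of_nonneg_left ?_ hDβ
    nlinarith
  linarith

/-- A zero at a positive angle would force `D π = 0` through the decreasing quotient, and then
monotonicity would make the total mass vanish. -/
theorem IsAngularDensity.pos (hD : IsAngularDensity D) (h1 : 0 < ∫ θ in (0 : ℝ)..π, D θ) {θ : ℝ}
    (hθ : 0 < θ) (hθπ : θ ≤ π) : 0 < D θ := by
  have h0 := hD.nonneg θ ⟨hθ.le, hθπ⟩
  by_contra hneg
  have hz : D θ = 0 := by linarith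
  have hs : 0 < sin (θ / 2) := sin_pos_of_pos_of_lt_pi (by linarith) (by linarith)
  have h2 := hD.anti θ π hθ.le hθπ le_rfl
  have h3 := hD.integral_le le_rfl pi_pos.le le_rfl
  have h4 : 0 < D π := by
    by_contra h
    have : D π * (π - 0) ≤ 0 := mul_nonpos_of_nonpos_of_nonneg (by linarith) (by simpa using pi_pos.le)
    linarith
  rw [hz, zero_mul] at h2
  have : 0 < D π * sin (θ / 2) ^ 2 := by positivity
  linarith

theorem intervalIntegrable_log_sub (φ : ℝ) :
    IntervalIntegrable (fun θ => log (θ - φ)) volume α β := by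
  have := (intervalIntegrable_log' (a := α - φ) (b := β - φ)).comp_sub_right φ
  simpa using this

/-- The distance from `z` is at least a constant times `(θ - φ)²`, with `φ` the nearest angle, so
the singularity is at worst `2 log |θ - φ|`. -/
theorem intervalIntegrable_log_norm_sub_arcParam (hab : a < b) (hα : 0 ≤ α)
    (hαβ : α ≤ β) (hβ : β ≤ π) (z : ℂ) :
    IntervalIntegrable (fun θ => log ‖z - (arcParam a b θ : ℂ)‖) volume α β := by
  suffices h : IntervalIntegrable (fun θ => log ‖z - (arcParam a b θ : ℂ)‖) volume 0 π by
    refine h.mono_set ?_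
    rw [Set.uIcc_of_le hαβ, Set.uIcc_of_le pi_pos.le]
    exact Set.Icc_subset_Icc hα hβ
  obtain ⟨φ, hφ, hφz⟩ := exists_arcParam_nearest hab le_rfl pi_pos.le le_rfl z
  have hL : 0 < b - a := by linarith
  set R := ‖z‖ + |a| + |b| + 1 with hR
  have hint : IntervalIntegrable
      (fun θ => |log R| + |log ((b - a) / π ^ 2)| + 2 * |log (θ - φ)|) volume 0 π :=
    intervalIntegrable_const.add ((intervalIntegrable_log_sub φ).abs.const_mul 2)
  have hmeas : Measurable (fun θ => log ‖z - (arcParam a b θ : ℂ)‖) := by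
    have := (continuous_arcParam a b).measurable
    fun_prop
  refine hint.mono_fun' hmeas.aestronglyMeasurable ?_
  rw [Set.uIoc_of_le pi_pos.le]
  have hne : ∀ᵐ θ ∂(volume.restrict (Set.Ioc 0 π)), θ ≠ φ :=
    ae_restrict_of_ae (by simp [ae_iff])
  filter_upwards [hne, ae_restrict_mem measurableSet_Ioc] with θ hθ hmem
  have hθ' : θ ∈ Set.Icc 0 π := ⟨hmem.1.le, hmem.2⟩
  have hmono := (strictMonoOn_arcParam hab).monotoneOn
  have hT : arcParam a b θ ∈ Set.Icc (arcParam a b 0) (arcParam a b π) :=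
    ⟨hmono ⟨le_rfl, pi_pos.le⟩ hθ' hθ'.1, hmono hθ' ⟨pi_pos.le, le_rfl⟩ hθ'.2⟩
  have h1 := (arcParam_dist_lower hab le_rfl pi_pos le_rfl hθ' hφ).trans (hφz _ hT)
  rw [arcParam_zero, arcParam_pi] at h1 hT
  have hsq : 0 < (θ - φ) ^ 2 := by have := sub_ne_zero.2 hθ; positivity
  have e1 : ((θ - φ) / (π - 0)) ^ 2 * (b - a) = (b - a) / π ^ 2 * (θ - φ) ^ 2 := by
    rw [sub_zero]; field_simp
  rw [e1] at h1
  have hpos : 0 < (b - a) / π ^ 2 * (θ - φ) ^ 2 := by positivity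
  have l1 := log_le_log hpos h1
  rw [log_mul (by positivity) (by positivity), log_pow] at l1
  have h2 : ‖z - (arcParam a b θ : ℂ)‖ ≤ R := by
    refine (norm_sub_le _ _).trans ?_
    rw [Complex.norm_real, norm_eq_abs]
    have := abs_le_max_abs_abs hT.1 hT.2
    have : max |a| |b| ≤ |a| + |b| := max_le_add_of_nonneg (abs_nonneg _) (abs_nonneg _)
    linarith
  have l2 := log_le_log (hpos.trans_le h1) h2
  rw [norm_eq_abs, abs_le]
  push_cast at l1
  constructor
  · linarith [neg_abs_le (log (θ - φ)), neg_abs_le (log ((b - a) / π ^ 2)), abs_nonneg (log R)]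
  · linarith [abs_nonneg (log (θ - φ)), abs_nonneg (log ((b - a) / π ^ 2)), le_abs_self (log R)]

theorem le_integral_log_sub {φ : ℝ} (hαβ : α < β) (hφ : φ ∈ Set.Icc α β) :
    (β - α) * log (β - α) - 2 * (β - α) ≤ ∫ θ in α..β, log (θ - φ) := by
  rw [intervalIntegral.integral_comp_sub_right (fun θ => log θ) φ, integral_log]
  have hδ : 0 < β - α := by linarith
  -- This is `log x ≤ x - 1` at `x = (β - α) / y`; it is applied to the two pieces into which `φ`
  -- cuts the interval.
  have key : ∀ y, 0 ≤ y → y * log (β - α) - (β - α - y) ≤ y * log y := by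
    intro y hy
    rcases hy.eq_or_lt with rfl | hy
    · simp only [zero_mul]; linarith
    have := log_le_sub_one_of_pos (div_pos hδ hy)
    rw [log_div hδ.ne' hy.ne'] at this
    have := mul_le_mul_of_nonneg_left this hy.le
    rw [mul_sub, mul_sub, mul_div_cancel₀ _ hy.ne'] at this
    linarith
  have k1 := key (β - φ) (by linarith [hφ.2])
  have k2 := key (φ - α) (by linarith [hφ.1])
  rw [← neg_sub φ α, log_neg_eq_log]
  nlinarith

/-- The bound for the contribution of an interval near `z`. -/
theorem IsAngularDensity.integral_log_sub_le_near (hD : IsAngularDensity D) (hab : a < b)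
    (hα : 0 ≤ α) (hαβ : α < β) (hβ : β ≤ π) {z : ℂ} {ξ : ℝ}
    (hξ : ξ ∈ Set.Icc (arcParam a b α) (arcParam a b β)) (hzξ : z ≠ ξ) :
    ∫ θ in α..β, (log ‖z - (ξ : ℂ)‖ - log ‖z - (arcParam a b θ : ℂ)‖) * D θ ≤
      15 * ∫ θ in α..β, D θ := by
  obtain ⟨φ, hφ, hφz⟩ := exists_arcParam_nearest hab hα hαβ.le hβ z
  have hmono := (strictMonoOn_arcParam hab).monotoneOn
  have hα' : α ∈ Set.Icc 0 π := ⟨hα, by linarith⟩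
  have hβ' : β ∈ Set.Icc 0 π := ⟨by linarith, hβ⟩
  have hh : arcParam a b α < arcParam a b β := strictMonoOn_arcParam hab hα' hβ' hαβ
  have hδ : 0 < β - α := by linarith
  have hDβ := hD.nonneg β hβ'
  have hq : IntervalIntegrable (fun θ => (log 2 + 2 * log (β - α)) - 2 * log (θ - φ))
      volume α β := intervalIntegrable_const.sub ((intervalIntegrable_log_sub φ).const_mul 2)
  have h1 : ∫ θ in α..β, (log ‖z - (ξ : ℂ)‖ - log ‖z - (arcParam a b θ : ℂ)‖) * D θ ≤
      ∫ θ in α..β, ((log 2 + 2 * log (β - α)) - 2 * log (θ - φ)) * D β := by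
    refine integral_mono_ae_restrict hαβ.le
      (hD.intervalIntegrable_mul hα hαβ.le hβ (intervalIntegrable_const.sub
        (intervalIntegrable_log_norm_sub_arcParam hab hα hαβ.le hβ z))) (hq.mul_const _) ?_
    have hne : ∀ᵐ θ ∂(volume.restrict (Set.Icc α β)), θ ≠ φ :=
      ae_restrict_of_ae (by simp [ae_iff])
    filter_upwards [hne, ae_restrict_mem measurableSet_Icc] with θ hθ hmem
    have hθ' : θ ∈ Set.Icc 0 π := ⟨hα.trans hmem.1, hmem.2.trans hβ⟩
    have hT : arcParam a b θ ∈ Set.Icc (arcParam a b α) (arcParam a b β) :=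
      ⟨hmono hα' hθ' hmem.1, hmono hθ' hβ' hmem.2⟩
    have d1 := (arcParam_dist_lower hab hα hαβ hβ hmem hφ).trans (hφz _ hT)
    set y := ((θ - φ) / (β - α)) ^ 2 with hy
    have hθφ : θ - φ ≠ 0 := sub_ne_zero.2 hθ
    have hy0 : 0 < y := by positivity
    have hy1 : y ≤ 1 := by
      rw [hy, div_pow, div_le_one (by positivity)]
      exact sq_le_sq' (by linarith [hmem.1, hφ.2]) (by linarith [hmem.2, hφ.1])
    set w := ‖z - (arcParam a b θ : ℂ)‖ with hw
    have hw0 : 0 < w := lt_of_lt_of_le (mul_pos hy0 (by linarith)) d1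
    have d2 : ‖z - (ξ : ℂ)‖ ≤ w + (arcParam a b β - arcParam a b α) := by
      have e : z - (ξ : ℂ) = (z - (arcParam a b θ : ℂ)) + ((arcParam a b θ - ξ : ℝ) : ℂ) := by
        push_cast; ring
      rw [e]
      refine (norm_add_le _ _).trans ?_
      rw [Complex.norm_real, norm_eq_abs]
      gcongr
      rw [abs_le]
      constructor <;> linarith [hT.1, hT.2, hξ.1, hξ.2]
    -- The interval length is at most `w / y` by `d1`, and `y ≤ 1`, so both summands of `d2` are at
    -- most `w` after multiplication by `y`.
    have d3 : y * ‖z - (ξ : ℂ)‖ ≤ 2 * w := by nlinarith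
    have hn0 : 0 < ‖z - (ξ : ℂ)‖ := norm_pos_iff.2 (sub_ne_zero.2 hzξ)
    have l := log_le_log (mul_pos hy0 hn0) d3
    rw [log_mul hy0.ne' hn0.ne', log_mul two_ne_zero hw0.ne', hy, log_pow,
      log_div hθφ hδ.ne'] at l
    push_cast at l
    have l0 := log_le_log hy0 hy1
    rw [hy, log_pow, log_div hθφ hδ.ne', log_one] at l0
    push_cast at l0
    have l2 : 0 < log 2 := log_pos (by norm_num)
    refine (mul_le_mul_of_nonneg_right (show _ ≤ (log 2 + 2 * log (β - α)) - 2 * log (θ - φ) by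
      linarith) (hD.nonneg θ hθ')).trans ?_
    exact mul_le_mul_of_nonneg_left (hD.mono hθ' hβ' hmem.2) (by linarith)
  refine h1.trans ?_
  rw [intervalIntegral.integral_mul_const, intervalIntegral.integral_sub intervalIntegrable_const
    ((intervalIntegrable_log_sub φ).const_mul 2), intervalIntegral.integral_const,
    intervalIntegral.integral_const_mul, smul_eq_mul]
  have l3 := le_integral_log_sub hαβ hφ
  have l4 : log 2 < 1 := by have := log_two_lt_d9; linarith
  -- The constant is `log 2 + 4 < 5`; the factor 3 of `le_integral` then gives 15.
  have l5 : (β - α) * (log 2 + 2 * log (β - α)) - 2 * ∫ θ in α..β, log (θ - φ) ≤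
      5 * (β - α) := by nlinarith
  have l6 := hD.le_integral hα hαβ.le hβ
  have := mul_le_mul_of_nonneg_right l5 hDβ
  linarith

/-- The second order estimate for the logarithm of a quotient of distances. -/
theorem log_norm_sub_sub_log_norm_sub_le {z : ℂ} {t ξ h d : ℝ} (hd : 0 < d)
    (ht : d ≤ ‖z - (t : ℂ)‖) (hξ : d ≤ ‖z - (ξ : ℂ)‖) (hh : |t - ξ| ≤ h) :
    log ‖z - (ξ : ℂ)‖ - log ‖z - (t : ℂ)‖ ≤
      (t - ξ) * ((z - (ξ : ℂ))⁻¹).re + 3 / 2 * (h / d) ^ 2 := by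
  have ht0 : 0 < ‖z - (t : ℂ)‖ := hd.trans_le ht
  have hξ0 : 0 < ‖z - (ξ : ℂ)‖ := hd.trans_le hξ
  have hh0 : 0 ≤ h := (abs_nonneg _).trans hh
  have hzt : z - (t : ℂ) ≠ 0 := norm_pos_iff.1 ht0
  have hzξ : z - (ξ : ℂ) ≠ 0 := norm_pos_iff.1 hξ0
  set v : ℂ := ((t - ξ : ℝ) : ℂ) / (z - t) with hv
  have hratio : ‖z - (ξ : ℂ)‖ / ‖z - (t : ℂ)‖ = ‖1 + v‖ := by
    rw [← norm_div]; congr 1; rw [hv]; field_simp; push_cast; ring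
  have hv1 : ‖v‖ ≤ h / d := by
    rw [hv, norm_div, Complex.norm_real, norm_eq_abs]
    gcongr
  -- Replacing the pole `t` by `ξ` makes the coefficient of `t - ξ` independent of `t`, so that the
  -- linear term integrates to zero. The quadratic error 1 here and 1/2 in `hlog` add up to 3/2.
  have hvre : v.re ≤ (t - ξ) * ((z - (ξ : ℂ))⁻¹).re + (h / d) ^ 2 := by
    have e : v = ((t - ξ : ℝ) : ℂ) * (z - ξ)⁻¹ +
        v * (((t - ξ : ℝ) : ℂ) / (z - ξ)) := by
      rw [hv]; field_simp; push_cast; ring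
    have e2 : v.re = (t - ξ) * ((z - (ξ : ℂ))⁻¹).re +
        (v * (((t - ξ : ℝ) : ℂ) / (z - ξ))).re := by
      conv_lhs => rw [e]
      rw [Complex.add_re, Complex.re_ofReal_mul]
    rw [e2]
    gcongr
    refine (Complex.re_le_norm _).trans ?_
    rw [norm_mul, sq]
    have h2 : ‖((t - ξ : ℝ) : ℂ) / (z - ξ)‖ ≤ h / d := by
      rw [norm_div, Complex.norm_real, norm_eq_abs]
      gcongr
    exact mul_le_mul hv1 h2 (norm_nonneg _) ((norm_nonneg _).trans hv1)
  have hlog : log ‖1 + v‖ ≤ v.re + ‖v‖ ^ 2 / 2 := by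
    have hpos : 0 < ‖1 + v‖ := by rw [← hratio]; positivity
    have h1 := log_le_sub_one_of_pos (show 0 < ‖1 + v‖ ^ 2 by positivity)
    rw [log_pow, ← Complex.normSq_eq_norm_sq, Complex.normSq_add] at h1
    rw [← Complex.normSq_eq_norm_sq]
    simp at h1
    linarith
  rw [← log_div hξ0.ne' ht0.ne', hratio]
  have : ‖v‖ ^ 2 ≤ (h / d) ^ 2 := by gcongr
  linarith

/-- The bound for the contribution of an interval at distance at least `d` from `z`. -/
theorem IsAngularDensity.integral_log_sub_le_far (hD : IsAngularDensity D) (hab : a < b)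
    (hα : 0 ≤ α) (hαβ : α ≤ β) (hβ : β ≤ π) {z : ℂ} {ξ d : ℝ} (hd : 0 < d)
    (hξ : ξ ∈ Set.Icc (arcParam a b α) (arcParam a b β))
    (hmean : ∫ θ in α..β, (arcParam a b θ - ξ) * D θ = 0)
    (hdist : ∀ s ∈ Set.Icc (arcParam a b α) (arcParam a b β), d ≤ ‖z - (s : ℂ)‖) :
    ∫ θ in α..β, (log ‖z - (ξ : ℂ)‖ - log ‖z - (arcParam a b θ : ℂ)‖) * D θ ≤
      3 / 2 * ((arcParam a b β - arcParam a b α) / d) ^ 2 * ∫ θ in α..β, D θ := by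
  set c := ((z - (ξ : ℂ))⁻¹).re
  set K := 3 / 2 * ((arcParam a b β - arcParam a b α) / d) ^ 2
  have hmono := (strictMonoOn_arcParam hab).monotoneOn
  have hi : IntervalIntegrable (fun θ => (arcParam a b θ - ξ) * D θ) volume α β :=
    hD.intervalIntegrable_mul hα hαβ hβ
      (((continuous_arcParam a b).sub continuous_const).intervalIntegrable _ _)
  have hi2 := hD.intervalIntegrable hα hαβ hβ
  have h := integral_mono_on (g := fun θ => c * ((arcParam a b θ - ξ) * D θ) + K * D θ) hαβ
    (hD.intervalIntegrable_mul hα hαβ hβ (intervalIntegrable_const.sub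
        (intervalIntegrable_log_norm_sub_arcParam hab hα hαβ hβ z)))
    ((hi.const_mul c).add (hi2.const_mul K)) (fun θ hmem => by
      have hθ' : θ ∈ Set.Icc 0 π := ⟨hα.trans hmem.1, hmem.2.trans hβ⟩
      have hT : arcParam a b θ ∈ Set.Icc (arcParam a b α) (arcParam a b β) :=
        ⟨hmono ⟨hα, by linarith⟩ hθ' hmem.1, hmono hθ' ⟨by linarith, hβ⟩ hmem.2⟩
      have := mul_le_mul_of_nonneg_right
        (log_norm_sub_sub_log_norm_sub_le hd (hdist _ hT) (hdist _ hξ)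
          (h := arcParam a b β - arcParam a b α) (by
            rw [abs_le]; constructor <;> linarith [hT.1, hT.2, hξ.1, hξ.2]))
        (hD.nonneg θ hθ')
      refine this.trans (le_of_eq ?_)
      ring)
  rwa [intervalIntegral.integral_add (hi.const_mul c) (hi2.const_mul K),
    intervalIntegral.integral_const_mul, intervalIntegral.integral_const_mul, hmean, mul_zero,
    zero_add] at h

/-- Jensen's inequality for the logarithm at a point outside `(a, b)`. -/
theorem IsAngularDensity.integral_log_sub_nonneg (hD : IsAngularDensity D) (hab : a < b)
    (hα : 0 ≤ α) (hαβ : α ≤ β) (hβ : β ≤ π) {x ξ : ℝ} (hx : x ∉ Set.Ioo a b)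
    (hξ : ξ ∈ Set.Ioo a b) (hmean : ∫ θ in α..β, (arcParam a b θ - ξ) * D θ = 0) :
    0 ≤ ∫ θ in α..β, (log ‖(x : ℂ) - (ξ : ℂ)‖ - log ‖(x : ℂ) - (arcParam a b θ : ℂ)‖) * D θ := by
  have hi : IntervalIntegrable (fun θ => (arcParam a b θ - ξ) * D θ) volume α β :=
    hD.intervalIntegrable_mul hα hαβ hβ
      (((continuous_arcParam a b).sub continuous_const).intervalIntegrable _ _)
  have h := integral_mono_on_of_le_Ioo (f := fun θ => (x - ξ)⁻¹ * ((arcParam a b θ - ξ) * D θ))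
    (g := fun θ => (log ‖(x : ℂ) - (ξ : ℂ)‖ - log ‖(x : ℂ) - (arcParam a b θ : ℂ)‖) * D θ) hαβ
    (hi.const_mul _)
    (hD.intervalIntegrable_mul hα hαβ hβ (intervalIntegrable_const.sub
        (intervalIntegrable_log_norm_sub_arcParam hab hα hαβ hβ x))) (fun θ hmem => by
      have hθ' : θ ∈ Set.Icc 0 π := ⟨hα.trans hmem.1.le, hmem.2.le.trans hβ⟩
      have hs := strictMonoOn_arcParam hab
      have t1 := hs ⟨le_rfl, pi_pos.le⟩ hθ' (by linarith [hmem.1])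
      have t2 := hs hθ' ⟨pi_pos.le, le_rfl⟩ (by linarith [hmem.2])
      rw [arcParam_zero] at t1
      rw [arcParam_pi] at t2
      set t := arcParam a b θ
      have hcase : x ≤ a ∨ b ≤ x := by
        by_contra hcon; push Not at hcon; exact hx hcon
      have hu : 0 < (x - t) / (x - ξ) := by
        rcases hcase with h | h
        · exact div_pos_of_neg_of_neg (by linarith) (by linarith [hξ.1])
        · exact div_pos (by linarith) (by linarith [hξ.2])
      have hne1 : x - ξ ≠ 0 := by rintro h; rw [h, div_zero] at hu; exact lt_irrefl _ hu
      have hne2 : x - t ≠ 0 := by rintro h; rw [h, zero_div] at hu; exact lt_irrefl _ hu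
      have hl := log_le_sub_one_of_pos hu
      rw [log_div hne2 hne1] at hl
      rw [← mul_assoc, ← Complex.ofReal_sub, ← Complex.ofReal_sub, Complex.norm_real,
        Complex.norm_real, norm_eq_abs, norm_eq_abs, log_abs, log_abs]
      refine mul_le_mul_of_nonneg_right ?_ (hD.nonneg θ hθ')
      have : (x - t) / (x - ξ) - 1 = - ((x - ξ)⁻¹ * (t - ξ)) := by field_simp; ring
      linarith)
  rwa [intervalIntegral.integral_const_mul, hmean, mul_zero] at h

end AngularDensity

/-! ### Decay of relative interval lengths and summation of the costs. -/

section IntervalBounds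

open Real intervalIntegral

variable {D : ℝ → ℝ} {a b α β φ N : ℝ}

/-- Comparing both masses with `D β` gives `N * r ≤ 3` for the ratio `r` of angular lengths, while
`h ≤ π * r * W`. The exponents are weaker than this yields, to match the left-hand case. -/
theorem IsAngularDensity.length_ratio_right (hD : IsAngularDensity D) (hab : a < b)
    (hφ : 0 ≤ φ) (hφα : φ ≤ α) (hαβ : α < β) (hβ : β ≤ π) (hM : 0 < ∫ θ in α..β, D θ)
    (hN : 0 ≤ N) (hmass : N * ∫ θ in α..β, D θ ≤ ∫ θ in φ..β, D θ) :
    (arcParam a b β - arcParam a b α) ^ 3 * N ^ 2 ≤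
      9 * π ^ 3 * (arcParam a b β - arcParam a b φ) ^ 3 := by
  have hh := arcParam_sub_le_right hab hφ hφα hαβ hβ
  have hmono := strictMonoOn_arcParam hab
  have hα' : α ∈ Set.Icc 0 π := ⟨by linarith, by linarith⟩
  have hβ' : β ∈ Set.Icc 0 π := ⟨by linarith, hβ⟩
  have hφ' : φ ∈ Set.Icc 0 π := ⟨hφ, by linarith⟩
  have h0 : arcParam a b α < arcParam a b β := hmono hα' hβ' hαβ
  have hW : arcParam a b φ < arcParam a b β := hmono hφ' hβ' (by linarith)
  have m1 := hD.le_integral (hφ.trans hφα) hαβ.le hβ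
  have m2 := hD.integral_le (hφ.trans hφα) hαβ.le hβ
  have m3 := hD.integral_le hφ (hφα.trans hαβ.le) hβ
  have hDβ : 0 < D β := by
    by_contra h
    have := mul_nonpos_of_nonpos_of_nonneg (not_lt.1 h) (show 0 ≤ β - α by linarith)
    linarith
  set W := arcParam a b β - arcParam a b φ
  set h := arcParam a b β - arcParam a b α
  have hW0 : 0 < W := by simp only [W]; linarith
  have hh0 : 0 < h := by simp only [h]; linarith
  set r := (β - α) / (β - φ) with hr
  have hlen : 0 < β - φ := by linarith
  have hr0 : 0 ≤ r := div_nonneg (by linarith) hlen.le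
  have hr1 : r ≤ 1 := by rw [hr, div_le_one hlen]; linarith
  have hrN : N * r ≤ 3 := by
    rw [hr, ← mul_div_assoc, div_le_iff₀ hlen]
    refine le_of_mul_le_mul_left ?_ hDβ
    nlinarith
  have hr3 : r ^ 3 * N ^ 2 ≤ 9 := by
    have e1 : (N * r) ^ 2 ≤ 3 ^ 2 := by gcongr
    have e2 : r * (N * r) ^ 2 ≤ 1 * 3 ^ 2 := mul_le_mul hr1 e1 (by positivity) (by norm_num)
    nlinarith
  calc h ^ 3 * N ^ 2 ≤ (π * r * W) ^ 3 * N ^ 2 := by gcongr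
    _ = (π ^ 3 * W ^ 3) * (r ^ 3 * N ^ 2) := by ring
    _ ≤ (π ^ 3 * W ^ 3) * 9 := by gcongr
    _ = _ := by ring

/-- With `S` the ratio of half-angle sines, the density may drop by `S²`, so the masses give only `N
* S² * r ≤ 3`, while `h ≤ π * S * r * W`. Since `r ≤ S`, `(S * r)³ ≤ (S² * r)²`; this is the source
of the exponent 2/3. -/
theorem IsAngularDensity.length_ratio_left (hD : IsAngularDensity D) (hab : a < b)
    (hα : 0 ≤ α) (hαβ : α < β) (hβφ : β ≤ φ) (hφ : φ ≤ π) (hM : 0 < ∫ θ in α..β, D θ)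
    (hN : 0 ≤ N) (hmass : N * ∫ θ in α..β, D θ ≤ ∫ θ in α..φ, D θ) :
    (arcParam a b β - arcParam a b α) ^ 3 * N ^ 2 ≤
      9 * π ^ 3 * (arcParam a b φ - arcParam a b α) ^ 3 := by
  have hh := arcParam_sub_le_left hab hα hαβ hβφ hφ
  have hS := div_le_sin_div_sin hα hαβ hβφ hφ
  have hmono := strictMonoOn_arcParam hab
  have hα' : α ∈ Set.Icc 0 π := ⟨hα, by linarith⟩
  have hβ' : β ∈ Set.Icc 0 π := ⟨by linarith, by linarith⟩
  have hφ' : φ ∈ Set.Icc 0 π := ⟨by linarith, hφ⟩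
  have h0 : arcParam a b α < arcParam a b β := hmono hα' hβ' hαβ
  have hW : arcParam a b α < arcParam a b φ := hmono hα' hφ' (by linarith)
  have m1 := hD.le_integral hα hαβ.le hβ'.2
  have m2 := hD.integral_le hα hαβ.le hβ'.2
  have m3 := hD.integral_le hα (hαβ.le.trans hβφ) hφ
  have m4 := hD.anti β φ hβ'.1 hβφ hφ
  have m5 := hD.mono hβ' hφ' hβφ
  have hDφ : 0 < D φ := by
    by_contra h
    have := mul_nonpos_of_nonpos_of_nonneg (m5.trans (not_lt.1 h)) (show 0 ≤ β - α by linarith)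
    linarith
  have hφ0 : 0 < sin (φ / 2) := sin_pos_of_pos_of_lt_pi (by linarith) (by linarith)
  set W := arcParam a b φ - arcParam a b α
  set h := arcParam a b β - arcParam a b α
  have hW0 : 0 < W := by simp only [W]; linarith
  have hh0 : 0 < h := by simp only [h]; linarith
  set r := (β - α) / (φ - α) with hr
  set S := sin (β / 2) / sin (φ / 2) with hSdef
  have hlen : 0 < φ - α := by linarith
  have hr0 : 0 ≤ r := div_nonneg (by linarith) hlen.le
  have hS0 : 0 ≤ S := hr0.trans hS
  have m6 : D φ * S ^ 2 ≤ D β := by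
    rw [hSdef, div_pow, ← mul_div_assoc, div_le_iff₀ (by positivity)]
    exact m4
  have hrN : N * (S ^ 2 * r) ≤ 3 := by
    have e : N * (S ^ 2 * r) = N * S ^ 2 * (β - α) / (φ - α) := by rw [hr]; ring
    rw [e, div_le_iff₀ hlen]
    refine le_of_mul_le_mul_left ?_ hDφ
    have c1 : D φ * S ^ 2 * (β - α) ≤ D β * (β - α) :=
      mul_le_mul_of_nonneg_right m6 (by linarith)
    have c2 := mul_le_mul_of_nonneg_left (c1.trans m1) hN
    linarith
  have hr3 : (S * r) ^ 3 * N ^ 2 ≤ 9 := by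
    have e1 : (N * (S ^ 2 * r)) ^ 2 ≤ 3 ^ 2 := by gcongr
    have e2 : (S * r) ^ 3 * N ^ 2 ≤ (N * (S ^ 2 * r)) ^ 2 := by
      have : r * (S ^ 3 * r ^ 2 * N ^ 2) ≤ S * (S ^ 3 * r ^ 2 * N ^ 2) := by gcongr
      linarith
    linarith
  calc h ^ 3 * N ^ 2 ≤ (π * (S * r) * W) ^ 3 * N ^ 2 := by gcongr
    _ = (π ^ 3 * W ^ 3) * ((S * r) ^ 3 * N ^ 2) := by ring
    _ ≤ (π ^ 3 * W ^ 3) * 9 := by gcongr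
    _ = _ := by ring

/-- The combination of the near and the far bound, for an interval of length `h` at distance
`W - h` from `z`. -/
theorem IsAngularDensity.integral_log_sub_le_of_length_ratio (hD : IsAngularDensity D)
    (hab : a < b) (hα : 0 ≤ α) (hαβ : α < β) (hβ : β ≤ π) {z : ℂ} {ξ W v : ℝ}
    (hξ : ξ ∈ Set.Icc (arcParam a b α) (arcParam a b β)) (hzξ : z ≠ ξ)
    (hmean : ∫ θ in α..β, (arcParam a b θ - ξ) * D θ = 0) (hW : 0 < W)
    (hdist : ∀ s ∈ Set.Icc (arcParam a b α) (arcParam a b β),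
      W - (arcParam a b β - arcParam a b α) ≤ ‖z - (s : ℂ)‖)
    (hv : 0 < v) (hvN : v ^ 3 * N = 1)
    (hratio : (arcParam a b β - arcParam a b α) ^ 3 * N ^ 2 ≤ 9 * π ^ 3 * W ^ 3) :
    ∫ θ in α..β, (log ‖z - (ξ : ℂ)‖ - log ‖z - (arcParam a b θ : ℂ)‖) * D θ ≤
      1323 * v ^ 4 * ∫ θ in α..β, D θ := by
  have hα' : α ∈ Set.Icc 0 π := ⟨hα, by linarith⟩
  have hβ' : β ∈ Set.Icc 0 π := ⟨by linarith, hβ⟩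
  have hh0 := strictMonoOn_arcParam hab hα' hβ' hαβ
  have hM : 0 ≤ ∫ θ in α..β, D θ :=
    integral_nonneg hαβ.le fun θ hθ => hD.nonneg θ ⟨hα.trans hθ.1, hθ.2.trans hβ⟩
  set h := arcParam a b β - arcParam a b α with hh
  have hh1 : 0 < h := by rw [hh]; linarith
  have hle : h ≤ 7 * v ^ 2 * W := by
    have hpi : 9 * π ^ 3 ≤ 7 ^ 3 := by
      have : π ^ 3 ≤ 3.15 ^ 3 := by
        have := pi_lt_d2; have := pi_pos; gcongr
      linarith
    refine le_of_pow_le_pow_left₀ (n := 3) (by norm_num) (by positivity) ?_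
    calc h ^ 3 = h ^ 3 * (v ^ 3 * N) ^ 2 := by rw [hvN]; ring
      _ = v ^ 6 * (h ^ 3 * N ^ 2) := by ring
      _ ≤ v ^ 6 * (9 * π ^ 3 * W ^ 3) := by gcongr
      _ ≤ v ^ 6 * (7 ^ 3 * W ^ 3) := by gcongr
      _ = _ := by ring
  -- If `h ≤ 3W/4`, then `d = W - h ≥ W/4` and the far bound gives `(3/2) * 28² = 1176`. Otherwise
  -- `v² > 3/28`, and 1323 is large enough for `1323 * v ^ 4` to exceed the near constant 15.
  by_cases hcase : 4 * h ≤ 3 * W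
  · have hd : 0 < W - h := by linarith
    refine (hD.integral_log_sub_le_far hab hα hαβ.le hβ hd hξ hmean hdist).trans ?_
    refine mul_le_mul_of_nonneg_right ?_ hM
    have h1 : h / (W - h) ≤ 28 * v ^ 2 := by
      rw [div_le_iff₀ hd]
      have : 28 * v ^ 2 * (W / 4) ≤ 28 * v ^ 2 * (W - h) := by gcongr; linarith
      linarith
    have h2 : (h / (W - h)) ^ 2 ≤ (28 * v ^ 2) ^ 2 := by gcongr
    have : 0 ≤ v ^ 4 := by positivity
    linarith
  · refine (hD.integral_log_sub_le_near hab hα hαβ hβ hξ hzξ).trans ?_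
    refine mul_le_mul_of_nonneg_right ?_ hM
    have h1 : 3 / 4 ≤ 7 * v ^ 2 := by
      refine le_of_mul_le_mul_right ?_ hW
      linarith
    nlinarith

theorem sum_range_distance_le {c : ℕ → ℝ} (hc : ∀ n, 0 ≤ c n) {S : ℝ}
    (hS : ∀ n, ∑ i ∈ Finset.range n, c (i + 1) ≤ S) (k m : ℕ) :
    ∑ j ∈ Finset.range k, c ((j - m) + (m - j)) ≤ c 0 + 2 * S := by
  have h1 : ∑ j ∈ Finset.range k, c ((j - m) + (m - j)) ≤
      ∑ j ∈ Finset.range (m + (k + 1)), c ((j - m) + (m - j)) :=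
    Finset.sum_le_sum_of_subset_of_nonneg (Finset.range_subset_range.2 (by omega))
      fun _ _ _ => hc _
  rw [Finset.sum_range_add, Finset.sum_range_succ' _ k] at h1
  have e1 : ∑ j ∈ Finset.range m, c ((j - m) + (m - j)) = ∑ j ∈ Finset.range m, c (j + 1) := by
    rw [← Finset.sum_range_reflect (fun j => c (j + 1))]
    refine Finset.sum_congr rfl fun j hj => ?_
    have := Finset.mem_range.1 hj
    congr 1; omega
  have e2 : ∑ i ∈ Finset.range k, c ((m + (i + 1) - m) + (m - (m + (i + 1)))) =
      ∑ i ∈ Finset.range k, c (i + 1) := by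
    refine Finset.sum_congr rfl fun j _ => ?_
    congr 1; omega
  rw [e1, e2] at h1
  simp only [add_zero, Nat.sub_self] at h1
  linarith [hS m, hS k]

/-- Telescoping: for `x = n^(-1/3)` and `y = (n + 1)^(-1/3)` one has `y⁴ ≤ 3 (x - y)`. -/
theorem sum_rpow_neg_one_third_pow_four_le (n : ℕ) :
    ∑ i ∈ Finset.range n, (((i + 1 : ℕ) : ℝ) ^ (-(1 / 3) : ℝ)) ^ 4 ≤ 4 := by
  have hcube : ∀ i : ℕ, (((i + 1 : ℕ) : ℝ) ^ (-(1 / 3) : ℝ)) ^ 3 * ((i + 1 : ℕ) : ℝ) = 1 := by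
    intro i
    have hi : (0 : ℝ) < ((i + 1 : ℕ) : ℝ) := by positivity
    rw [← rpow_natCast, ← rpow_mul hi.le]
    norm_num
    rw [rpow_neg_one]
    exact inv_mul_cancel₀ (by positivity)
  have key : ∀ n : ℕ, ∑ i ∈ Finset.range (n + 1), (((i + 1 : ℕ) : ℝ) ^ (-(1 / 3) : ℝ)) ^ 4 ≤
      4 - 3 * ((n + 1 : ℕ) : ℝ) ^ (-(1 / 3) : ℝ) := by
    intro n
    induction n with
    | zero => norm_num
    | succ n ih =>
      rw [Finset.sum_range_succ]
      have hx := hcube n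
      have hy := hcube (n + 1)
      have hx0 : (0 : ℝ) < ((n + 1 : ℕ) : ℝ) ^ (-(1 / 3) : ℝ) := by positivity
      have hy0 : (0 : ℝ) < ((n + 1 + 1 : ℕ) : ℝ) ^ (-(1 / 3) : ℝ) := by positivity
      set x := ((n + 1 : ℕ) : ℝ) ^ (-(1 / 3) : ℝ)
      set y := ((n + 1 + 1 : ℕ) : ℝ) ^ (-(1 / 3) : ℝ)
      have e : ((n + 1 + 1 : ℕ) : ℝ) = ((n + 1 : ℕ) : ℝ) + 1 := by push_cast; ring
      rw [e] at hy
      have h3 : x ^ 3 - y ^ 3 = x ^ 3 * y ^ 3 := by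
        linear_combination y ^ 3 * hx - x ^ 3 * hy
      have hyx : y ≤ x := by
        refine le_of_pow_le_pow_left₀ (n := 3) (by norm_num) hx0.le ?_
        have : 0 ≤ x ^ 3 * y ^ 3 := by positivity
        linarith
      have h4 : x ^ 2 * (x * y ^ 3) ≤ x ^ 2 * (3 * (x - y)) := by
        have : (x - y) * (x ^ 2 + x * y + y ^ 2) ≤ (x - y) * (3 * x ^ 2) := by
          refine mul_le_mul_of_nonneg_left ?_ (by linarith)
          nlinarith
        linarith
      have h5 := le_of_mul_le_mul_left h4 (by positivity)
      have h6 : y * y ^ 3 ≤ x * y ^ 3 := by gcongr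
      linarith
  rcases n with _ | n
  · norm_num
  · have := key n
    have h0 : (0 : ℝ) < ((n + 1 : ℕ) : ℝ) ^ (-(1 / 3) : ℝ) := by positivity
    linarith

end IntervalBounds

/-! ### The equal-mass partition and the sum over its intervals. -/

section Partition

open Real intervalIntegral

variable {D : ℝ → ℝ} {a b : ℝ} {k : ℕ} {τ ξ : ℕ → ℝ}

theorem IsAngularDensity.integral_lt_integral (hD : IsAngularDensity D)
    (h1 : ∫ θ in (0 : ℝ)..π, D θ = 1) {x y : ℝ} (hx : 0 ≤ x) (hxy : x < y) (hy : y ≤ π) :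
    ∫ θ in (0 : ℝ)..x, D θ < ∫ θ in (0 : ℝ)..y, D θ := by
  have h := integral_add_adjacent_intervals (hD.intervalIntegrable le_rfl hx (hxy.le.trans hy))
    (hD.intervalIntegrable hx hxy.le hy)
  have := intervalIntegral_pos_of_pos_on (hD.intervalIntegrable hx hxy.le hy)
    (fun θ hθ => hD.pos (by rw [h1]; exact one_pos) (hx.trans_lt hθ.1) (hθ.2.le.trans hy)) hxy
  linarith

theorem IsAngularDensity.exists_partition (hD : IsAngularDensity D)
    (h1 : ∫ θ in (0 : ℝ)..π, D θ = 1) (hk : 0 < k) :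
    ∃ τ : ℕ → ℝ, τ 0 = 0 ∧ τ k = π ∧ ∀ i ≤ k, τ i ∈ Set.Icc 0 π ∧
      ∫ θ in (0 : ℝ)..τ i, D θ = i / k := by
  have hk' : (0 : ℝ) < k := by exact_mod_cast hk
  have hcont : ContinuousOn (fun x => ∫ θ in (0 : ℝ)..x, D θ) (Set.Icc 0 π) := by
    have := continuousOn_primitive_interval (a := 0) (b := π) (f := D) (μ := volume)
      ((intervalIntegrable_iff' (by finiteness)).1 (hD.intervalIntegrable le_rfl pi_pos.le le_rfl))
    rwa [Set.uIcc_of_le pi_pos.le] at this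
  have hex : ∀ i : ℕ, ∃ x, i ≤ k → x ∈ Set.Icc 0 π ∧ ∫ θ in (0 : ℝ)..x, D θ = i / k := by
    intro i
    by_cases hi : i ≤ k
    · have hi' : (i : ℝ) ≤ k := by exact_mod_cast hi
      obtain ⟨x, hx, hxe⟩ := intermediate_value_Icc pi_pos.le hcont
        (show (i / k : ℝ) ∈ _ by
          simp only [integral_same, h1]
          exact ⟨by positivity, (div_le_one hk').2 hi'⟩)
      exact ⟨x, fun _ => ⟨hx, hxe⟩⟩
    · exact ⟨0, fun h => absurd h hi⟩
  choose τ hτ using hex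
  -- The end values are prescribed, so that the partition starts and ends exactly at `0` and `π`.
  refine ⟨fun i => if i = 0 then 0 else if i = k then π else τ i, by simp, by simp [hk.ne'], ?_⟩
  intro i hi
  by_cases h0 : i = 0
  · simp [h0, pi_pos.le]
  by_cases hik : i = k
  · simp [hik, hk.ne', pi_pos.le, h1]
  · simpa [h0, hik] using hτ i hi

theorem IsAngularDensity.partition_lt (hD : IsAngularDensity D)
    (h1 : ∫ θ in (0 : ℝ)..π, D θ = 1)
    (hτ : ∀ i ≤ k, τ i ∈ Set.Icc 0 π ∧ ∫ θ in (0 : ℝ)..τ i, D θ = i / k)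
    {i j : ℕ} (hij : i < j) (hj : j ≤ k) : τ i < τ j := by
  have hk' : (0 : ℝ) < k := by exact_mod_cast (by omega : 0 < k)
  by_contra hle
  obtain ⟨h2, h3⟩ := hτ i (by omega)
  obtain ⟨h4, h5⟩ := hτ j hj
  have hij' : (i / k : ℝ) < j / k := by gcongr
  rcases (not_lt.1 hle).eq_or_lt with h | h
  · rw [h, h3] at h5; linarith
  · have := hD.integral_lt_integral h1 h4.1 h h2.2
    linarith

theorem IsAngularDensity.partition_mass (hD : IsAngularDensity D)
    (h1 : ∫ θ in (0 : ℝ)..π, D θ = 1)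
    (hτ : ∀ i ≤ k, τ i ∈ Set.Icc 0 π ∧ ∫ θ in (0 : ℝ)..τ i, D θ = i / k)
    {j : ℕ} (hj : j < k) : ∫ θ in τ j..τ (j + 1), D θ = 1 / k := by
  obtain ⟨h2, h3⟩ := hτ j (by omega)
  obtain ⟨h4, h5⟩ := hτ (j + 1) (by omega)
  have h := integral_add_adjacent_intervals (hD.intervalIntegrable le_rfl h2.1 h2.2)
    (hD.intervalIntegrable h2.1 (hD.partition_lt h1 hτ (Nat.lt_succ_self j) hj).le h4.2)
  rw [h3, h5] at h
  push_cast at h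
  rw [add_div] at h
  linarith

theorem IsAngularDensity.sum_integral_log_sub_le (hD : IsAngularDensity D) (hab : a < b)
    (h1 : ∫ θ in (0 : ℝ)..π, D θ = 1)
    (hτ : ∀ i ≤ k, τ i ∈ Set.Icc 0 π ∧ ∫ θ in (0 : ℝ)..τ i, D θ = i / k)
    (hξ : ∀ j < k, ξ j ∈ Set.Ioo (arcParam a b (τ j)) (arcParam a b (τ (j + 1))))
    (hmean : ∀ j < k, ∫ θ in τ j..τ (j + 1), (arcParam a b θ - ξ j) * D θ = 0)
    {z : ℂ} (hz : ∀ j < k, z ≠ ξ j) :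
    k * ∑ j ∈ Finset.range k, ∫ θ in τ j..τ (j + 1),
      (log ‖z - (ξ j : ℂ)‖ - log ‖z - (arcParam a b θ : ℂ)‖) * D θ ≤ 15383 := by
  rcases Nat.eq_zero_or_pos k with rfl | hk
  · norm_num
  have hk' : (0 : ℝ) < k := by exact_mod_cast hk
  obtain ⟨φ, hφ, hφz⟩ := exists_arcParam_nearest hab le_rfl pi_pos.le le_rfl z
  have hsm := strictMonoOn_arcParam hab
  have hmono := hsm.monotoneOn
  have hF0 : 0 ≤ ∫ θ in (0 : ℝ)..φ, D θ :=
    integral_nonneg hφ.1 fun θ hθ => hD.nonneg θ ⟨hθ.1, hθ.2.trans hφ.2⟩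
  set y := k * ∫ θ in (0 : ℝ)..φ, D θ with hy
  have hFy : ∫ θ in (0 : ℝ)..φ, D θ = y / k := by rw [hy]; field_simp
  -- `m` is the index of the interval containing `φ`, or `k` when `φ = π`. At least `|j - m|` units
  -- of mass `1 / k` lie between `φ` and the far end of interval `j`; with truncated subtraction,
  -- `(j - m) + (m - j)` is `|j - m|`.
  set m := ⌊y⌋₊ with hm
  have hmy : (m : ℝ) ≤ y := Nat.floor_le (by positivity)
  have hym : y < m + 1 := Nat.lt_floor_add_one y
  set v : ℕ → ℝ := fun n => ((n : ℕ) : ℝ) ^ (-(1 / 3) : ℝ) with hv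
  have hv0 : ∀ n : ℕ, 0 < n → 0 < v n := fun n hn => by
    have : (0 : ℝ) < n := by exact_mod_cast hn
    simp only [hv]; positivity
  have hv3 : ∀ n : ℕ, 0 < n → v n ^ 3 * n = 1 := fun n hn => by
    have hn' : (0 : ℝ) < n := by exact_mod_cast hn
    simp only [hv]
    rw [← rpow_natCast, ← rpow_mul hn'.le]
    norm_num
    rw [rpow_neg_one]
    exact inv_mul_cancel₀ (by positivity)
  set c : ℕ → ℝ := fun n => if n = 0 then 15 else 1323 * v n ^ 4 with hc
  have hc0 : ∀ n, 0 ≤ c n := fun n => by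
    simp only [hc]
    split_ifs with h
    · norm_num
    · have := hv0 n (Nat.pos_of_ne_zero h)
      positivity
  have hS : ∀ n, ∑ i ∈ Finset.range n, c (i + 1) ≤ 1323 * 4 := fun n => by
    have := mul_le_mul_of_nonneg_left (sum_rpow_neg_one_third_pow_four_le n)
      (show (0 : ℝ) ≤ 1323 by norm_num)
    rw [Finset.mul_sum] at this
    simpa [hc, hv] using this
  have hsum := sum_range_distance_le hc0 hS k m
  have hterm : ∀ j ∈ Finset.range k, k * ∫ θ in τ j..τ (j + 1),
      (log ‖z - (ξ j : ℂ)‖ - log ‖z - (arcParam a b θ : ℂ)‖) * D θ ≤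
        c ((j - m) + (m - j)) := by
    intro j hj
    have hjk := Finset.mem_range.1 hj
    have hα := (hτ j hjk.le).1
    have hβ := (hτ (j + 1) hjk).1
    have hlt := hD.partition_lt h1 hτ (Nat.lt_succ_self j) hjk
    have hmass := hD.partition_mass h1 hτ hjk
    have hMpos : 0 < ∫ θ in τ j..τ (j + 1), D θ := by rw [hmass]; positivity
    have hξj : ξ j ∈ Set.Icc (arcParam a b (τ j)) (arcParam a b (τ (j + 1))) :=
      Set.Ioo_subset_Icc_self (hξ j hjk)
    have hrange : ∀ s ∈ Set.Icc (arcParam a b (τ j)) (arcParam a b (τ (j + 1))),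
        s ∈ Set.Icc (arcParam a b 0) (arcParam a b π) := fun s hs =>
      ⟨(hmono ⟨le_rfl, pi_pos.le⟩ hα hα.1).trans hs.1,
        hs.2.trans (hmono hβ ⟨pi_pos.le, le_rfl⟩ hβ.2)⟩
    have hFβ := (hτ (j + 1) hjk).2
    have hFα := (hτ j hjk.le).2
    push_cast at hFβ
    rcases lt_trichotomy j m with hjm | hjm | hjm
    · have hcast : (j : ℝ) + 1 ≤ m := by exact_mod_cast hjm
      have hβφ : τ (j + 1) ≤ φ := by
        by_contra h
        have := hD.integral_lt_integral h1 hφ.1 (not_le.1 h) hβ.2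
        rw [hFβ, hFy, div_lt_div_iff_of_pos_right hk'] at this
        linarith
      have hαφ : τ j < φ := hlt.trans_le hβφ
      have hN : 0 < m - j := by omega
      have hNcast : ((m - j : ℕ) : ℝ) = m - j := Nat.cast_sub hjm.le
      have hadd := integral_add_adjacent_intervals (hD.intervalIntegrable le_rfl hα.1 hα.2)
        (hD.intervalIntegrable hα.1 hαφ.le hφ.2)
      have hr := hD.length_ratio_left hab hα.1 hlt hβφ hφ.2 hMpos
        (N := ((m - j : ℕ) : ℝ)) (by positivity) (by
          have e : ∫ θ in τ j..φ, D θ = (y - j) / k := by rw [sub_div]; linarith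
          rw [hmass, e, hNcast, mul_one_div]
          gcongr)
      have := hD.integral_log_sub_le_of_length_ratio hab hα.1 hlt hβ.2 hξj (hz j hjk)
        (hmean j hjk) (sub_pos.2 (hsm hα hφ hαφ)) (fun s hs => by
          refine le_trans ?_ (hφz s (hrange s hs))
          refine le_trans ?_ (le_abs_self _)
          linarith [hs.2]) (hv0 _ hN) (hv3 _ hN) hr
      rw [hmass] at this
      have e0 : j - m + (m - j) = m - j := by omega
      rw [e0]
      simp only [hc, if_neg hN.ne']
      have := mul_le_mul_of_nonneg_left this hk'.le
      refine this.trans (le_of_eq ?_)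
      field_simp
    · have := hD.integral_log_sub_le_near hab hα.1 hlt hβ.2 hξj (hz j hjk)
      rw [hmass] at this
      have := mul_le_mul_of_nonneg_left this hk'.le
      refine this.trans (le_of_eq ?_)
      simp [hc, hjm]
      field_simp
    · have hcast : (m : ℝ) + 1 ≤ j := by exact_mod_cast hjm
      have hφα : φ ≤ τ j := by
        by_contra h
        have := hD.integral_lt_integral h1 hα.1 (not_le.1 h) hφ.2
        rw [hFα, hFy, div_lt_div_iff_of_pos_right hk'] at this
        linarith
      have hφβ : φ < τ (j + 1) := hφα.trans_lt hlt
      have hN : 0 < j - m := by omega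
      have hNcast : ((j - m : ℕ) : ℝ) = j - m := Nat.cast_sub hjm.le
      have hadd := integral_add_adjacent_intervals (hD.intervalIntegrable le_rfl hφ.1 hφ.2)
        (hD.intervalIntegrable hφ.1 hφβ.le hβ.2)
      have hr := hD.length_ratio_right hab hφ.1 hφα hlt hβ.2 hMpos
        (N := ((j - m : ℕ) : ℝ)) (by positivity) (by
          have e : ∫ θ in φ..τ (j + 1), D θ = (j + 1 - y) / k := by rw [sub_div]; linarith
          rw [hmass, e, hNcast, mul_one_div]
          exact div_le_div_of_nonneg_right (by linarith) hk'.le)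
      have := hD.integral_log_sub_le_of_length_ratio hab hα.1 hlt hβ.2 hξj (hz j hjk)
        (hmean j hjk) (sub_pos.2 (hsm hφ hβ hφβ)) (fun s hs => by
          refine le_trans ?_ (hφz s (hrange s hs))
          rw [abs_sub_comm]
          refine le_trans ?_ (le_abs_self _)
          linarith [hs.1]) (hv0 _ hN) (hv3 _ hN) hr
      rw [hmass] at this
      have e0 : j - m + (m - j) = j - m := by omega
      rw [e0]
      simp only [hc, if_neg hN.ne']
      have := mul_le_mul_of_nonneg_left this hk'.le
      refine this.trans (le_of_eq ?_)
      field_simp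
  rw [Finset.mul_sum]
  refine (Finset.sum_le_sum hterm).trans (hsum.trans ?_)
  -- The total is `15 + 2 * 1323 * 4 = 10599`, below the stated constant.
  simp only [hc, if_true]
  norm_num

theorem IsAngularDensity.sum_integral_log_sub_eq (hD : IsAngularDensity D) (hab : a < b)
    (h1 : ∫ θ in (0 : ℝ)..π, D θ = 1) (hk : 0 < k) (hτ0 : τ 0 = 0) (hτk : τ k = π)
    (hτ : ∀ i ≤ k, τ i ∈ Set.Icc 0 π ∧ ∫ θ in (0 : ℝ)..τ i, D θ = i / k) (z : ℂ) :
    k * ∑ j ∈ Finset.range k, ∫ θ in τ j..τ (j + 1),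
      (log ‖z - (ξ j : ℂ)‖ - log ‖z - (arcParam a b θ : ℂ)‖) * D θ =
    ∑ j ∈ Finset.range k, log ‖z - (ξ j : ℂ)‖ -
      k * ∫ θ in (0 : ℝ)..π, log ‖z - (arcParam a b θ : ℂ)‖ * D θ := by
  have hk' : (0 : ℝ) < k := by exact_mod_cast hk
  have hi : ∀ j < k, IntervalIntegrable
      (fun θ => log ‖z - (arcParam a b θ : ℂ)‖ * D θ) volume (τ j) (τ (j + 1)) := fun j hj => by
    have h3 := (hD.partition_lt h1 hτ (Nat.lt_succ_self j) hj).le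
    have h4 := (hτ j hj.le).1.1
    have h5 := (hτ (j + 1) hj).1.2
    exact hD.intervalIntegrable_mul h4 h3 h5
      (intervalIntegrable_log_norm_sub_arcParam hab h4 h3 h5 z)
  have hs := sum_integral_adjacent_intervals hi
  rw [hτ0, hτk] at hs
  have he : ∀ j ∈ Finset.range k, ∫ θ in τ j..τ (j + 1),
      (log ‖z - (ξ j : ℂ)‖ - log ‖z - (arcParam a b θ : ℂ)‖) * D θ =
      log ‖z - (ξ j : ℂ)‖ * (1 / k) -
        ∫ θ in τ j..τ (j + 1), log ‖z - (arcParam a b θ : ℂ)‖ * D θ := fun j hj => by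
    have hj := Finset.mem_range.1 hj
    have h3 := (hD.partition_lt h1 hτ (Nat.lt_succ_self j) hj).le
    have h4 := (hτ j hj.le).1.1
    have h5 := (hτ (j + 1) hj).1.2
    simp only [sub_mul]
    rw [integral_sub ((hD.intervalIntegrable h4 h3 h5).const_mul _) (hi j hj),
      intervalIntegral.integral_const_mul, hD.partition_mass h1 hτ hj]
  rw [Finset.sum_congr rfl he, Finset.sum_sub_distrib, hs, ← Finset.sum_mul, mul_sub]
  congr 1
  field_simp

/-- The first moment about `r` is `ξ - r` times the mass, and positivity of the density fixes its
sign at both endpoints. -/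
theorem IsAngularDensity.mean_mem_Ioo (hD : IsAngularDensity D) (hab : a < b)
    (h1 : ∫ θ in (0 : ℝ)..π, D θ = 1) {α β ξ : ℝ} (hα : 0 ≤ α) (hαβ : α < β) (hβ : β ≤ π)
    (hmean : ∫ θ in α..β, (arcParam a b θ - ξ) * D θ = 0) :
    ξ ∈ Set.Ioo (arcParam a b α) (arcParam a b β) := by
  have hpos : ∀ θ ∈ Set.Ioo α β, 0 < D θ := fun θ hθ =>
    hD.pos (by rw [h1]; exact one_pos) (hα.trans_lt hθ.1) (hθ.2.le.trans hβ)
  have hM := intervalIntegral_pos_of_pos_on (hD.intervalIntegrable hα hαβ.le hβ) hpos hαβ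
  have hi : ∀ r : ℝ, IntervalIntegrable (fun θ => (arcParam a b θ - r) * D θ) volume α β :=
    fun r => hD.intervalIntegrable_mul hα hαβ.le hβ
      (((continuous_arcParam a b).sub continuous_const).intervalIntegrable _ _)
  have hshift : ∀ r : ℝ, ∫ θ in α..β, (arcParam a b θ - r) * D θ =
      (ξ - r) * ∫ θ in α..β, D θ := fun r => by
    have e : (fun θ => (arcParam a b θ - r) * D θ) =
        fun θ => (arcParam a b θ - ξ) * D θ + (ξ - r) * D θ := by ext θ; ring
    rw [e, integral_add (hi ξ) ((hD.intervalIntegrable hα hαβ.le hβ).const_mul _), hmean,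
      intervalIntegral.integral_const_mul, zero_add]
  have hsm := strictMonoOn_arcParam hab
  have hmem : ∀ θ ∈ Set.Icc α β, θ ∈ Set.Icc 0 π := fun θ hθ =>
    ⟨hα.trans hθ.1, hθ.2.trans hβ⟩
  constructor
  · have := intervalIntegral_pos_of_pos_on (hi (arcParam a b α)) (fun θ hθ =>
      mul_pos (sub_pos.2 (hsm (hmem α ⟨le_rfl, hαβ.le⟩) (hmem θ ⟨hθ.1.le, hθ.2.le⟩) hθ.1))
        (hpos θ hθ)) hαβ
    rw [hshift] at this
    linarith [pos_of_mul_pos_left this hM.le]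
  · have := intervalIntegral_pos_of_pos_on (hi (arcParam a b β)).neg (fun θ hθ => by
      have := mul_pos (sub_pos.2 (hsm (hmem θ ⟨hθ.1.le, hθ.2.le⟩) (hmem β ⟨hαβ.le, le_rfl⟩) hθ.2))
        (hpos θ hθ)
      simp only [Pi.neg_apply]
      linarith) hαβ
    simp only [Pi.neg_apply] at this
    rw [intervalIntegral.integral_neg, hshift, ← neg_mul] at this
    linarith [pos_of_mul_pos_left this hM.le]

end Partition

/-! ### From the measure on `[a, b]` to the angular density. -/

section Transfer

open Real intervalIntegral

variable {g : ℝ → ℝ} {a b : ℝ}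

/-- The chord from `r` to `t` lies below the graph at `s`; drop `g r ≥ 0` and let `r` tend to `a`,
where `g` need not be defined by continuity. -/
theorem ConcaveOn.mul_sub_le_of_nonneg (hg : ConcaveOn ℝ (Set.Ioo a b) g)
    (hg0 : ∀ t ∈ Set.Ioo a b, 0 ≤ g t) {s t : ℝ} (hs : a < s) (hst : s ≤ t) (ht : t < b) :
    g t * (s - a) ≤ g s * (t - a) := by
  rcases hst.eq_or_lt with rfl | hst
  · exact le_rfl
  have hlim : Filter.Tendsto (fun r => g s * (t - r) - g t * (s - r)) (nhdsWithin a (Set.Ioi a))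
      (nhds (g s * (t - a) - g t * (s - a))) := by
    refine Filter.Tendsto.mono_left ?_ nhdsWithin_le_nhds
    exact Continuous.tendsto (by fun_prop) a
  have hev : ∀ᶠ r in nhdsWithin a (Set.Ioi a), 0 ≤ g s * (t - r) - g t * (s - r) := by
    filter_upwards [Ioo_mem_nhdsGT hs] with r hr
    have htr : 0 < t - r := by linarith [hr.2]
    have hr' : r ∈ Set.Ioo a b := ⟨hr.1, by linarith [hr.2]⟩
    have h := hg.2 hr' (show t ∈ Set.Ioo a b from ⟨by linarith, ht⟩)
      (show 0 ≤ (t - s) / (t - r) from div_nonneg (by linarith) htr.le)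
      (show 0 ≤ (s - r) / (t - r) from div_nonneg (by linarith [hr.2]) htr.le)
      (by field_simp; ring)
    simp only [smul_eq_mul] at h
    have e : (t - s) / (t - r) * r + (s - r) / (t - r) * t = s := by field_simp; ring
    rw [e] at h
    have h2 := mul_le_mul_of_nonneg_right h htr.le
    have e2 : ((t - s) / (t - r) * g r + (s - r) / (t - r) * g t) * (t - r) =
      (t - s) * g r + (s - r) * g t := by field_simp
    rw [e2] at h2
    have := mul_nonneg (show 0 ≤ t - s by linarith) (hg0 r hr')
    linarith
  have := ge_of_tendsto hlim hev
  linarith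

/-- The density in the angular variable, extended by its limit to the endpoint `π`. -/
noncomputable def angularDensity (a b : ℝ) (g : ℝ → ℝ) (θ : ℝ) : ℝ :=
  (if θ ≤ 0 then 0 else if θ < π then g (arcParam a b θ) else sSup (g '' Set.Ioo a b)) / π

theorem arcParam_mem_Ioo (hab : a < b) {θ : ℝ} (hθ : θ ∈ Set.Ioo 0 π) :
    arcParam a b θ ∈ Set.Ioo a b := by
  have h := strictMonoOn_arcParam hab
  have h1 := h ⟨le_rfl, pi_pos.le⟩ (Set.Ioo_subset_Icc_self hθ) hθ.1
  have h2 := h (Set.Ioo_subset_Icc_self hθ) ⟨pi_pos.le, le_rfl⟩ hθ.2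
  rw [arcParam_zero] at h1
  rw [arcParam_pi] at h2
  exact ⟨h1, h2⟩

theorem angularDensity_of_mem_Ioo {θ : ℝ} (hθ : θ ∈ Set.Ioo 0 π) :
    angularDensity a b g θ = g (arcParam a b θ) / π := by
  simp [angularDensity, hθ.1.not_ge, hθ.2]

theorem arcParam_sub_left (a b θ : ℝ) : arcParam a b θ - a = (b - a) * sin (θ / 2) ^ 2 := by
  have h := cos_sq' (θ / 2)
  have h2 := cos_sq (θ / 2)
  rw [mul_div_cancel₀ _ two_ne_zero] at h2
  unfold arcParam
  linear_combination (b - a) * h2 - (b - a) * h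

theorem isAngularDensity_angularDensity (hab : a < b)
    (hg0 : ∀ t ∈ Set.Ioo a b, 0 ≤ g t) (hg : ConcaveOn ℝ (Set.Ioo a b) g)
    (hmono : MonotoneOn g (Set.Ioo a b)) : IsAngularDensity (angularDensity a b g) := by
  have hne : (g '' Set.Ioo a b).Nonempty := (Set.nonempty_Ioo.2 hab).image g
  have hL : 0 < b - a := by linarith
  -- This bounds `g` above, so its supremum is a legitimate value at `π`, and gives the quotient
  -- inequality at that endpoint.
  have hupper : ∀ s ∈ Set.Ioo a b, ∀ t ∈ Set.Ioo a b, g t * (s - a) ≤ g s * (b - a) := by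
    intro s hs t ht
    rcases le_total s t with h | h
    · exact (hg.mul_sub_le_of_nonneg hg0 hs.1 h ht.2).trans
        (mul_le_mul_of_nonneg_left (by linarith [ht.2]) (hg0 s hs))
    · exact mul_le_mul (hmono ht hs h) (by linarith [hs.2]) (by linarith [hs.1]) (hg0 s hs)
  have hbdd : BddAbove (g '' Set.Ioo a b) := by
    have hc : (a + b) / 2 ∈ Set.Ioo a b := ⟨by linarith, by linarith⟩
    refine ⟨g ((a + b) / 2) * (b - a) / ((a + b) / 2 - a), ?_⟩
    rintro _ ⟨t, ht, rfl⟩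
    rw [le_div_iff₀ (by linarith)]
    exact hupper _ hc t ht
  have hsup0 : 0 ≤ sSup (g '' Set.Ioo a b) := by
    obtain ⟨t, ht⟩ := Set.nonempty_Ioo.2 hab
    exact (hg0 t ht).trans (le_csSup hbdd ⟨t, ht, rfl⟩)
  have hnn : ∀ θ ∈ Set.Icc 0 π, 0 ≤ angularDensity a b g θ := by
    intro θ hθ
    unfold angularDensity
    refine div_nonneg ?_ pi_pos.le
    split_ifs with h1 h2
    · exact le_rfl
    · exact hg0 _ (arcParam_mem_Ioo hab ⟨not_le.1 h1, h2⟩)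
    · exact hsup0
  have hsm := (strictMonoOn_arcParam hab).monotoneOn
  refine ⟨hnn, ?_, ?_⟩
  · intro θ hθ θ' hθ' h
    rcases hθ.1.eq_or_lt with h0 | h0
    · have : angularDensity a b g θ = 0 := by simp [angularDensity, ← h0]
      rw [this]; exact hnn _ hθ'
    · unfold angularDensity
      rw [if_neg h0.not_ge, if_neg (h0.trans_le h).not_ge]
      gcongr
      split_ifs with h1 h2 h2
      · exact hmono (arcParam_mem_Ioo hab ⟨h0, h1⟩)
          (arcParam_mem_Ioo hab ⟨h0.trans_le h, h2⟩) (hsm hθ hθ' h)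
      · exact le_csSup hbdd ⟨_, arcParam_mem_Ioo hab ⟨h0, h1⟩, rfl⟩
      · exact absurd (h.trans_lt h2) h1
      · exact le_rfl
  · intro θ θ' h0 h hπ
    rcases h0.eq_or_lt with h0 | h0
    · rw [← h0, zero_div, sin_zero]
      have := hnn 0 ⟨le_rfl, pi_pos.le⟩
      have : 0 ≤ angularDensity a b g 0 * sin (θ' / 2) ^ 2 := by positivity
      linarith
    rcases (h.trans hπ).eq_or_lt with h1 | h1
    · have : θ' = θ := by linarith
      rw [this]
    have hs := arcParam_mem_Ioo hab (show θ ∈ Set.Ioo 0 π from ⟨h0, h1⟩)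
    rw [angularDensity_of_mem_Ioo ⟨h0, h1⟩]
    rcases hπ.eq_or_lt with h2 | h2
    · have e : angularDensity a b g θ' = sSup (g '' Set.Ioo a b) / π := by
        simp [angularDensity, h2, pi_pos.not_ge]
      have hle : sSup (g '' Set.Ioo a b) * sin (θ / 2) ^ 2 ≤ g (arcParam a b θ) := by
        have hsθ : 0 < sin (θ / 2) := sin_pos_of_pos_of_lt_pi (by linarith) (by linarith)
        rw [← le_div_iff₀ (by positivity)]
        refine csSup_le hne ?_
        rintro _ ⟨t, ht, rfl⟩
        rw [le_div_iff₀ (by positivity)]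
        have := hupper _ hs t ht
        rw [arcParam_sub_left] at this
        refine le_of_mul_le_mul_right ?_ hL
        linarith
      rw [e, h2, sin_pi_div_two, one_pow, mul_one, div_mul_eq_mul_div]
      gcongr
    · rw [angularDensity_of_mem_Ioo ⟨h0.trans_le h, h2⟩, div_mul_eq_mul_div, div_mul_eq_mul_div]
      have := hg.mul_sub_le_of_nonneg hg0 hs.1
        (hsm ⟨h0.le, h1.le⟩ ⟨(h0.trans_le h).le, h2.le⟩ h)
        (arcParam_mem_Ioo hab ⟨h0.trans_le h, h2⟩).2
      rw [arcParam_sub_left, arcParam_sub_left] at this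
      refine div_le_div_of_nonneg_right ?_ pi_pos.le
      refine le_of_mul_le_mul_right ?_ hL
      linarith

theorem image_arcParam_Ioo (hab : a < b) {α β : ℝ} (hα : 0 ≤ α) (hαβ : α ≤ β) (hβ : β ≤ π) :
    arcParam a b '' Set.Ioo α β = Set.Ioo (arcParam a b α) (arcParam a b β) := by
  refine Set.Subset.antisymm ?_
    (intermediate_value_Ioo hαβ (continuous_arcParam a b).continuousOn)
  rintro _ ⟨θ, hθ, rfl⟩
  have hsm := strictMonoOn_arcParam hab
  have hθ' : θ ∈ Set.Icc 0 π := ⟨hα.trans hθ.1.le, hθ.2.le.trans hβ⟩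
  exact ⟨hsm ⟨hα, hαβ.trans hβ⟩ hθ' hθ.1, hsm hθ' ⟨hα.trans hαβ, hβ⟩ hθ.2⟩

/-- The arcsine-type density with numerator `g`. -/
noncomputable def arcsineWeight (a b : ℝ) (g : ℝ → ℝ) (t : ℝ) : ENNReal :=
  ENNReal.ofReal (g t / (π * √((t - a) * (b - t))))

theorem aemeasurable_arcsineWeight (hmono : MonotoneOn g (Set.Ioo a b)) :
    AEMeasurable (arcsineWeight a b g) (volume.restrict (Set.Ioo a b)) := by
  have hg : AEMeasurable g (volume.restrict (Set.Ioo a b)) :=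
    aemeasurable_restrict_of_monotoneOn measurableSet_Ioo hmono
  have hm : Measurable fun t : ℝ => π * √((t - a) * (b - t)) := by fun_prop
  exact (hg.div hm.aemeasurable).ennreal_ofReal

/-- The Jacobian `(b - a) sin θ / 2` is exactly `√((t - a) * (b - t))`, so it cancels the arcsine
denominator. -/
theorem abs_deriv_smul_arcsineWeight (hab : a < b) (hg0 : ∀ t ∈ Set.Ioo a b, 0 ≤ g t)
    (f : ℝ → ℝ) {θ : ℝ} (hθ : θ ∈ Set.Ioo 0 π) :
    |(b - a) * sin θ / 2| • ((arcsineWeight a b g (arcParam a b θ)).toReal • f (arcParam a b θ)) =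
      f (arcParam a b θ) * angularDensity a b g θ := by
  have hs : 0 < sin θ := sin_pos_of_pos_of_lt_pi hθ.1 hθ.2
  have hL : 0 < b - a := by linarith
  have hp : 0 < (b - a) * sin θ / 2 := by positivity
  have hsq : (arcParam a b θ - a) * (b - arcParam a b θ) = ((b - a) * sin θ / 2) ^ 2 := by
    have := sin_sq θ
    unfold arcParam
    linear_combination -(b - a) ^ 2 / 4 * this
  rw [arcsineWeight, hsq, sqrt_sq hp.le, ENNReal.toReal_ofReal
    (div_nonneg (hg0 _ (arcParam_mem_Ioo hab hθ)) (by positivity)),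
    angularDensity_of_mem_Ioo hθ, abs_of_pos hp, smul_eq_mul, smul_eq_mul]
  field_simp

theorem integral_arcsine_Ioo (hab : a < b) (hg0 : ∀ t ∈ Set.Ioo a b, 0 ≤ g t)
    (hmono : MonotoneOn g (Set.Ioo a b)) {α β : ℝ} (hα : 0 ≤ α) (hαβ : α ≤ β) (hβ : β ≤ π)
    (f : ℝ → ℝ) :
    ∫ t, f t ∂((volume.restrict (Set.Ioo (arcParam a b α) (arcParam a b β))).withDensity
      (arcsineWeight a b g)) = ∫ θ in α..β, f (arcParam a b θ) * angularDensity a b g θ := by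
  have hsub : Set.Ioo α β ⊆ Set.Ioo 0 π := Set.Ioo_subset_Ioo hα hβ
  have hsub' : Set.Ioo (arcParam a b α) (arcParam a b β) ⊆ Set.Ioo a b := by
    rw [← image_arcParam_Ioo hab hα hαβ hβ]
    rintro _ ⟨θ, hθ, rfl⟩
    exact arcParam_mem_Ioo hab (hsub hθ)
  rw [integral_withDensity_eq_integral_toReal_smul₀
    ((aemeasurable_arcsineWeight hmono).mono_measure (Measure.restrict_mono hsub' le_rfl))
    (ae_of_all _ fun t => ENNReal.ofReal_lt_top),
    ← image_arcParam_Ioo hab hα hαβ hβ,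
    integral_image_eq_integral_abs_deriv_smul measurableSet_Ioo
      (fun θ _ => (hasDerivAt_arcParam a b θ).hasDerivWithinAt)
      ((strictMonoOn_arcParam hab).injOn.mono (hsub.trans Set.Ioo_subset_Icc_self)),
    intervalIntegral.integral_of_le hαβ, integral_Ioc_eq_integral_Ioo]
  exact setIntegral_congr_fun measurableSet_Ioo fun θ hθ =>
    abs_deriv_smul_arcsineWeight hab hg0 f (hsub hθ)

theorem integrable_arcsine (hab : a < b) (hg0 : ∀ t ∈ Set.Ioo a b, 0 ≤ g t)
    (hmono : MonotoneOn g (Set.Ioo a b)) {f : ℝ → ℝ}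
    (hf : IntervalIntegrable (fun θ => f (arcParam a b θ) * angularDensity a b g θ)
      volume 0 π) :
    Integrable f ((volume.restrict (Set.Ioo a b)).withDensity (arcsineWeight a b g)) := by
  have himg := image_arcParam_Ioo hab le_rfl pi_pos.le le_rfl
  rw [arcParam_zero, arcParam_pi] at himg
  rw [integrable_withDensity_iff_integrable_smul₀' (aemeasurable_arcsineWeight hmono)
    (ae_of_all _ fun t => ENNReal.ofReal_lt_top)]
  change IntegrableOn _ _ _
  rw [← himg, integrableOn_image_iff_integrableOn_abs_deriv_smul measurableSet_Ioo
      (fun θ _ => (hasDerivAt_arcParam a b θ).hasDerivWithinAt)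
      ((strictMonoOn_arcParam hab).injOn.mono Set.Ioo_subset_Icc_self)]
  rw [intervalIntegrable_iff_integrableOn_Ioo_of_le pi_pos.le] at hf
  exact hf.congr_fun (fun θ hθ => (abs_deriv_smul_arcsineWeight hab hg0 f hθ).symm)
    measurableSet_Ioo

theorem integral_arcsine_Icc (hab : a < b) (hg0 : ∀ t ∈ Set.Ioo a b, 0 ≤ g t)
    (hmono : MonotoneOn g (Set.Ioo a b)) {α β : ℝ} (hα : 0 ≤ α) (hαβ : α ≤ β) (hβ : β ≤ π)
    (f : ℝ → ℝ) :
    ∫ t in Set.Icc (arcParam a b α) (arcParam a b β), f t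
      ∂((volume.restrict (Set.Ioo a b)).withDensity (arcsineWeight a b g)) =
    ∫ θ in α..β, f (arcParam a b θ) * angularDensity a b g θ := by
  rw [← integral_arcsine_Ioo hab hg0 hmono hα hαβ hβ, restrict_withDensity measurableSet_Icc,
    Measure.restrict_restrict measurableSet_Icc]
  congr 2
  refine Measure.restrict_congr_set ?_
  have hsub' : Set.Ioo (arcParam a b α) (arcParam a b β) ⊆ Set.Ioo a b := by
    rw [← image_arcParam_Ioo hab hα hαβ hβ]
    rintro _ ⟨θ, hθ, rfl⟩
    exact arcParam_mem_Ioo hab (Set.Ioo_subset_Ioo hα hβ hθ)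
  have h1 : (Set.Icc (arcParam a b α) (arcParam a b β) ∩ Set.Ioo a b : Set ℝ) =ᵐ[volume]
      (Set.Ioo (arcParam a b α) (arcParam a b β) ∩ Set.Ioo a b : Set ℝ) :=
    Ioo_ae_eq_Icc.symm.inter (Filter.EventuallyEq.refl _ _)
  rwa [Set.inter_eq_left.2 hsub'] at h1

end Transfer

/-! ### The logarithm of the polynomial and the main theorem. -/

theorem logAbs_prod_X_sub_C {k : ℕ} (ξ : Fin k → ℝ) {z : ℂ} (hz : ∀ j, z ≠ ξ j) :
    logAbs (∏ j, (X - C (ξ j))) z = ((∑ j, Real.log ‖z - (ξ j : ℂ)‖ : ℝ) : EReal) := by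
  have hpos : ∀ j, 0 < ‖z - (ξ j : ℂ)‖ := fun j => norm_pos_iff.2 (sub_ne_zero.2 (hz j))
  have hev : aeval z (∏ j, (X - C (ξ j))) = ∏ j, (z - (ξ j : ℂ)) := by
    rw [map_prod]
    simp
  rw [logAbs, hev, ← ofReal_norm, norm_prod, ENNReal.log_ofReal_of_pos
    (Finset.prod_pos fun j _ => hpos j), Real.log_prod fun j _ => (hpos j).ne']

theorem logAbs_prod_X_sub_C_self {k : ℕ} (ξ : Fin k → ℝ) {z : ℂ} {j : Fin k} (hz : z = ξ j) :
    logAbs (∏ j, (X - C (ξ j))) z = ⊥ := by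
  have hev : aeval z (∏ j, (X - C (ξ j))) = 0 := by
    rw [map_prod]
    exact Finset.prod_eq_zero (Finset.mem_univ j) (by simp [hz])
  simp [logAbs, hev]

theorem mainTheorem2 (a b : ℝ) (hab : a < b) (g : ℝ → ℝ)
    (hg_nonneg : ∀ t ∈ Set.Ioo a b, 0 ≤ g t)
    (hg_concave : ConcaveOn ℝ (Set.Ioo a b) g)
    (hg_mono : MonotoneOn g (Set.Ioo a b))
    (hg_convex : ConvexOn ℝ (Set.Ioo a b) (fun t => g t / (t - a)))
    (μ : Measure ℝ) [IsProbabilityMeasure μ]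
    (hμ : μ = (volume.restrict (Set.Ioo a b)).withDensity
      (fun t => ENNReal.ofReal (g t / (Real.pi * √((t - a) * (b - t)))))) :
    (∀ z : ℂ, Integrable (fun t : ℝ => Real.log (1 / ‖z - (t : ℂ)‖)) μ) ∧
    ∀ k : ℕ, 2 ≤ k → ∃ (t : Fin (k + 1) → ℝ) (P : ℝ[X]),
      IsEqualMassPartition μ a b k t ∧
      P = weightedMidpointPolynomial μ t ∧ P.Monic ∧ P.natDegree = k ∧
      (∀ z : ℂ, logAbs P z + ((k * logPotential μ z : ℝ) : EReal) ≤ (constBW : EReal)) ∧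
      (∀ x : ℝ, x ∉ Set.Ioo a b →
        0 ≤ logAbs P (x : ℂ) + ((k * logPotential μ (x : ℂ) : ℝ) : EReal)) := by
  have hμ' : μ = (volume.restrict (Set.Ioo a b)).withDensity (arcsineWeight a b g) := hμ
  set D := angularDensity a b g with hDdef
  have hD : IsAngularDensity D := isAngularDensity_angularDensity hab hg_nonneg hg_concave hg_mono
  have hint : ∀ f : ℝ → ℝ, ∫ t, f t ∂μ = ∫ θ in (0 : ℝ)..Real.pi, f (arcParam a b θ) * D θ := by
    intro f
    have := integral_arcsine_Ioo hab hg_nonneg hg_mono le_rfl Real.pi_pos.le le_rfl f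
    rwa [arcParam_zero, arcParam_pi, ← hμ'] at this
  have hintIcc : ∀ (f : ℝ → ℝ) {α β : ℝ}, 0 ≤ α → α ≤ β → β ≤ Real.pi →
      ∫ t in Set.Icc (arcParam a b α) (arcParam a b β), f t ∂μ =
        ∫ θ in α..β, f (arcParam a b θ) * D θ := by
    intro f α β hα hαβ hβ
    have := integral_arcsine_Icc hab hg_nonneg hg_mono hα hαβ hβ f
    rwa [← hμ'] at this
  have h1 : ∫ θ in (0 : ℝ)..Real.pi, D θ = 1 := by
    have := hint fun _ => 1
    simpa using this.symm
  have hlog : ∀ z : ℂ, IntervalIntegrable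
      (fun θ => Real.log ‖z - (arcParam a b θ : ℂ)‖ * D θ) volume 0 Real.pi := fun z =>
    hD.intervalIntegrable_mul le_rfl Real.pi_pos.le le_rfl
      (intervalIntegrable_log_norm_sub_arcParam hab le_rfl Real.pi_pos.le le_rfl z)
  have hpot : ∀ z : ℂ, logPotential μ z =
      -∫ θ in (0 : ℝ)..Real.pi, Real.log ‖z - (arcParam a b θ : ℂ)‖ * D θ := by
    intro z
    rw [logPotential, hint, ← intervalIntegral.integral_neg]
    simp only [one_div, Real.log_inv, neg_mul]
  refine ⟨fun z => ?_, fun k hk2 => ?_⟩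
  · rw [hμ']
    refine integrable_arcsine hab hg_nonneg hg_mono ?_
    simp only [one_div, Real.log_inv, neg_mul]
    exact (hlog z).neg
  have hk : 0 < k := by omega
  have hk' : (0 : ℝ) < k := by exact_mod_cast hk
  obtain ⟨τ, hτ0, hτk, hτ⟩ := hD.exists_partition h1 hk
  set ξ : ℕ → ℝ := fun j => k * ∫ θ in τ j..τ (j + 1), arcParam a b θ * D θ with hξdef
  have hstep : ∀ j < k, 0 ≤ τ j ∧ τ j < τ (j + 1) ∧ τ (j + 1) ≤ Real.pi := fun j hj =>
    ⟨(hτ j hj.le).1.1, hD.partition_lt h1 hτ (Nat.lt_succ_self j) hj, (hτ (j + 1) hj).1.2⟩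
  have hmean : ∀ j < k, ∫ θ in τ j..τ (j + 1), (arcParam a b θ - ξ j) * D θ = 0 := by
    intro j hj
    obtain ⟨h2, h3, h4⟩ := hstep j hj
    have hDi := hD.intervalIntegrable h2 h3.le h4
    simp only [sub_mul]
    rw [intervalIntegral.integral_sub (hD.intervalIntegrable_mul h2 h3.le h4
      ((continuous_arcParam a b).intervalIntegrable _ _)) (hDi.const_mul _),
      intervalIntegral.integral_const_mul, hD.partition_mass h1 hτ hj]
    simp only [hξdef]
    field_simp
    simp
  have hξ : ∀ j < k, ξ j ∈ Set.Ioo (arcParam a b (τ j)) (arcParam a b (τ (j + 1))) :=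
    fun j hj => by
      obtain ⟨h2, h3, h4⟩ := hstep j hj
      exact hD.mean_mem_Ioo hab h1 h2 h3 h4 (hmean j hj)
  set t : Fin (k + 1) → ℝ := fun i => arcParam a b (τ i) with ht
  have hmass : ∀ j : Fin k, μ.real (Set.Icc (t j.castSucc) (t j.succ)) = 1 / (k : ℝ) := by
    intro j
    obtain ⟨h2, h3, h4⟩ := hstep j j.2
    have := hintIcc (fun _ => 1) h2 h3.le h4
    simp only [one_mul] at this
    rw [hD.partition_mass h1 hτ j.2, setIntegral_const, smul_eq_mul, mul_one] at this
    simpa [ht] using this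
  have hmid : ∀ j : Fin k, weightedMidpoint μ t j = ξ j := by
    intro j
    obtain ⟨h2, h3, h4⟩ := hstep j j.2
    rw [weightedMidpoint, hmass j]
    have := hintIcc (fun s => s) h2 h3.le h4
    simp only [ht, Fin.val_castSucc, Fin.val_succ, this, hξdef]
    field_simp
  have hP : weightedMidpointPolynomial μ t = ∏ j : Fin k, (X - C (ξ j)) := by
    simp only [weightedMidpointPolynomial, hmid]
  have hvalue : ∀ z : ℂ, (∀ j : Fin k, z ≠ ξ j) →
      logAbs (weightedMidpointPolynomial μ t) z + ((k * logPotential μ z : ℝ) : EReal) =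
      ((k * ∑ j ∈ Finset.range k, ∫ θ in τ j..τ (j + 1),
        (Real.log ‖z - (ξ j : ℂ)‖ - Real.log ‖z - (arcParam a b θ : ℂ)‖) * D θ : ℝ) : EReal) := by
    intro z hz
    rw [hP, logAbs_prod_X_sub_C (fun j : Fin k => ξ j) hz, ← EReal.coe_add,
      hD.sum_integral_log_sub_eq hab h1 hk hτ0 hτk hτ, hpot,
      Fin.sum_univ_eq_sum_range (fun j => Real.log ‖z - (ξ j : ℂ)‖)]
    congr 1
    ring
  refine ⟨t, weightedMidpointPolynomial μ t, ⟨?_, ?_, ?_, hmass⟩, rfl, ?_, ?_, ?_, ?_⟩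
  · intro i j hij
    exact strictMonoOn_arcParam hab (hτ i (Nat.lt_succ_iff.1 i.2)).1
      (hτ j (Nat.lt_succ_iff.1 j.2)).1 (hD.partition_lt h1 hτ hij (Nat.lt_succ_iff.1 j.2))
  · simp [ht, hτ0, arcParam_zero]
  · simp [ht, hτk, arcParam_pi]
  · exact monic_prod_of_monic _ _ fun j _ => monic_X_sub_C _
  · rw [hP, natDegree_prod_of_monic _ _ fun j _ => monic_X_sub_C _]
    simp
  · intro z
    -- At a zero of the polynomial the left side is `⊥`, so the upper bound is trivial there; for
    -- the lower bound the zeros lie in `(a, b)` and are never met.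
    by_cases hz : ∀ j : Fin k, z ≠ ξ j
    · rw [hvalue z hz, constBW, EReal.coe_le_coe_iff]
      exact hD.sum_integral_log_sub_le hab h1 hτ hξ hmean fun j hj => hz ⟨j, hj⟩
    · push Not at hz
      obtain ⟨j, hj⟩ := hz
      rw [hP, logAbs_prod_X_sub_C_self (fun j : Fin k => ξ j) hj, EReal.bot_add]
      exact bot_le
  · intro x hx
    have hsm := (strictMonoOn_arcParam hab).monotoneOn
    have hξab : ∀ j < k, ξ j ∈ Set.Ioo a b := by
      intro j hj
      obtain ⟨h2, h3, h4⟩ := hstep j hj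
      have e1 := hsm ⟨le_rfl, Real.pi_pos.le⟩ (hτ j hj.le).1 h2
      have e2 := hsm (hτ (j + 1) hj).1 ⟨Real.pi_pos.le, le_rfl⟩ h4
      rw [arcParam_zero] at e1
      rw [arcParam_pi] at e2
      exact ⟨e1.trans_lt (hξ j hj).1, (hξ j hj).2.trans_le e2⟩
    have hz : ∀ j : Fin k, (x : ℂ) ≠ ξ j := by
      intro j h
      rw [Complex.ofReal_inj] at h
      exact hx (h ▸ hξab j j.2)
    rw [hvalue x hz, ← EReal.coe_zero, EReal.coe_le_coe_iff]
    refine mul_nonneg hk'.le (Finset.sum_nonneg fun j hj => ?_)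
    have hj := Finset.mem_range.1 hj
    obtain ⟨h2, h3, h4⟩ := hstep j hj
    exact hD.integral_log_sub_nonneg hab h2 h3.le h4 hx (hξab j hj) (hmean j hj)
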